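/- Let $k\ge 2$ be an integer and $0<\epsilon<1$. For $|a|<1$ let $q_a(y)=y+a\,y(1-y)$, which maps $I=[0,1]$ diffeomorphically onto itself, and put $p(x)=\epsilon\cos(2\pi x)$ for $x\in\mathbb R/\mathbb Z$ and $f_x=q_{p(x)}^{-1}:I\to I$. Let $\mathcal C=(\mathbb R/\mathbb Z)\times I$ be the cylinder, with normalized Lebesgue measure $\lambda$, and let $F:\mathcal C\to\mathcal C$, $F(x,y)=(kx,\,f_x(y))$. Then: 1. Every $f_x$ is an orientation preserving $C^\infty$ diffeomorphism of $I$. Its Schwarzian derivative $\mathcal S f_x=\frac{f_x'''}{f_x'}-\frac32\bigl(\frac{f_x''}{f_x'}\bigr)^2$ satisfies $\mathcal S f_x(y)>0$ for all $y\in I$ whenever $p(x)\neq 0$; in particular $\mathcal S f_x(y)>0$ for almost all $(x,y)\in\mathcal C$. Both transverse Lyapunov exponents $\int_{\mathbb R/\mathbb Z}\log f_x'(c)\,dx$, $c=0,1$, are strictly positive. 2. Over every point $(x,y)\in\mathbb R\times I$ the map $F$ has exactly $k$ inverse branches $$G_j(x,y)=\Bigl(\tfrac{x+j}k,\ y+\epsilon\cos\bigl(2\pi\tfrac{x+j}k\bigr)\,y(1-y)\Bigr),\qquad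 0\le j<k,$$ that is, the points $G_j(x,y)$, read modulo $1$ in the first coordinate, are distinct and are exactly the preimages under $F$ of $(x \bmod 1,\,y)$. The Jacobian determinant of $G_j$ at $(x,y)$ is $\bigl(1+\epsilon\cos(2\pi\tfrac{x+j}k)(1-2y)\bigr)/k>0$, and the sum of these $k$ Jacobians is $1$. 3. The measure $\lambda$ is $F$-invariant. 4. The measure $\lambda$ is the asymptotic measure of $F$: for $\lambda$-almost every $(x_0,y_0)\in\mathcal C$, with orbit $(x_i,y_i)=F^{\circ i}(x_0,y_0)$, and for every continuous $\chi:\mathcal C\to\mathbb R$, $$\frac1n\sum_{i=0}^{n-1}\chi(x_i,y_i)\ \longrightarrow\ \int_{\mathcal C}\chi\,d\lambda\qquad(n\to\infty),$$ and $\lambda$ is the only probability measure on $\mathcal C$ with this property (in which "almost every" always refers to Lebesgue measure). Thus almost every orbit is uniformly distributed with respect to Lebesgue measure. -/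

import Mathlib

open Set Filter Topology MeasureTheory
open scoped ContDiff

noncomputable section

/-- The cylinder `(ℝ/ℤ) × [0,1]`. It carries the product topology, and its `volume` is the
standard (normalized) Lebesgue measure. -/
abbrev Cylinder : Type := UnitAddCircle × unitInterval

/-- The quadratic map `q_a(y) = y + a y (1 - y)`. -/
def kanQ (a y : ℝ) : ℝ := y + a * y * (1 - y)

/-- The inverse of the bijection `q_a : [0,1] → [0,1]` (where `|a| < 1`). Only its values on `[0,1]`
are meaningful. -/
def kanQInv (a : ℝ) : ℝ → ℝ := Function.invFunOn (kanQ a) (Icc 0 1)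

theorem kanQ_strictMonoOn {a : ℝ} (ha : |a| < 1) : StrictMonoOn (kanQ a) (Icc 0 1) := by
  obtain ⟨h1, h2⟩ := abs_lt.mp ha
  intro y hy z hz hyz
  have key : kanQ a z - kanQ a y = (z - y) * (1 + a * (1 - y - z)) := by
    unfold kanQ; ring
  have h3 : 0 < 1 + a * (1 - y - z) := by
    have h4 : |a * (1 - y - z)| < 1 := by
      rw [abs_mul]
      have h5 : |1 - y - z| ≤ 1 := abs_le.mpr ⟨by linarith [hy.2, hz.2], by linarith [hy.1, hz.1]⟩
      calc |a| * |1 - y - z| ≤ |a| * 1 := by gcongr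
        _ < 1 := by simpa using ha
    linarith [(abs_lt.mp h4).1]
  have := mul_pos (sub_pos.mpr hyz) h3
  linarith

theorem kanQ_bijOn {a : ℝ} (ha : |a| < 1) : BijOn (kanQ a) (Icc 0 1) (Icc 0 1) := by
  have hm := kanQ_strictMonoOn ha
  have h0 : kanQ a 0 = 0 := by simp [kanQ]
  have h1 : kanQ a 1 = 1 := by simp [kanQ]
  refine ⟨fun y hy => ⟨?_, ?_⟩, hm.injOn, ?_⟩
  · rw [← h0]; exact hm.monotoneOn (by simp) hy hy.1
  · rw [← h1]; exact hm.monotoneOn hy (by simp) hy.2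
  · have hc : ContinuousOn (kanQ a) (Icc 0 1) := by unfold kanQ; fun_prop
    have := intermediate_value_Icc (zero_le_one (α := ℝ)) hc
    rwa [h0, h1] at this

/-- For `|a| < 1`, `kanQInv a` is the two-sided inverse of `kanQ a` on `[0,1]`. -/
theorem kanQInv_invOn {a : ℝ} (ha : |a| < 1) :
    InvOn (kanQInv a) (kanQ a) (Icc 0 1) (Icc 0 1) :=
  (kanQ_bijOn ha).invOn_invFunOn

theorem kanQInv_mem {a : ℝ} (ha : |a| < 1) {y : ℝ} (hy : y ∈ Icc (0 : ℝ) 1) :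
    kanQInv a y ∈ Icc (0 : ℝ) 1 :=
  Function.invFunOn_mem ((kanQ_bijOn ha).surjOn hy)

theorem cos_two_pi_mul_periodic (ε : ℝ) :
    Function.Periodic (fun t : ℝ => ε * Real.cos (2 * Real.pi * t)) 1 := by
  intro t
  simp only [mul_add, mul_one, Real.cos_add_two_pi]

/-- The function `p(x) = ε cos(2πx)` on the circle `ℝ/ℤ`. -/
def kanP (ε : ℝ) : UnitAddCircle → ℝ := (cos_two_pi_mul_periodic ε).lift

theorem kanP_coe (ε t : ℝ) : kanP ε (t : UnitAddCircle) = ε * Real.cos (2 * Real.pi * t) := rfl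

theorem abs_kanP_lt_one {ε : ℝ} (h0 : 0 < ε) (h1 : ε < 1) (x : UnitAddCircle) :
    |kanP ε x| < 1 := by
  induction x using QuotientAddGroup.induction_on with
  | H t =>
    change |ε * Real.cos (2 * Real.pi * t)| < 1
    rw [abs_mul, abs_of_pos h0]
    calc ε * |Real.cos (2 * Real.pi * t)| ≤ ε * 1 := by gcongr; exact Real.abs_cos_le_one _
      _ < 1 := by simpa using h1

/-- The fibre maps `f_x = (q_{p(x)})⁻¹` of the unit interval. -/
def kanFiber (ε : ℝ) (x : UnitAddCircle) : ℝ → ℝ := kanQInv (kanP ε x)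

/-- The projection of the strip `ℝ × [0,1]` onto the cylinder (only used when `0 ≤ z.2 ≤ 1`,
where `Set.projIcc` is the identity). -/
def toCylinder (z : ℝ × ℝ) : Cylinder := ((z.1 : UnitAddCircle), Set.projIcc 0 1 zero_le_one z.2)

/-- The cylinder map `F(x,y) = (k x, f_x(y))` given by maps `f_x` of `[0,1]` into itself. The
map `Set.projIcc` only serves to land in the subtype, it is the identity on `[0,1]`. -/
def cylinderMap (k : ℕ) (f : UnitAddCircle → ℝ → ℝ) (z : Cylinder) : Cylinder :=
  (k • z.1, Set.projIcc 0 1 zero_le_one (f z.1 z.2))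

theorem cylinderMap_kanFiber_snd {ε : ℝ} (h0 : 0 < ε) (h1 : ε < 1) (k : ℕ) (z : Cylinder) :
    ((cylinderMap k (kanFiber ε) z).2 : ℝ) = kanFiber ε z.1 z.2 := by
  have h := kanQInv_mem (abs_kanP_lt_one h0 h1 z.1) z.2.2
  exact congrArg Subtype.val (Set.projIcc_of_mem zero_le_one h)

/-- The Schwarzian derivative `f'''/f' - (3/2) (f''/f')²` of a map of the interval `[0,1]`
(one-sided derivatives at the end points). -/
def schwarzian (f : ℝ → ℝ) (y : ℝ) : ℝ :=
  iteratedDerivWithin 3 f (Icc 0 1) y / derivWithin f (Icc 0 1) y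
    - 3 / 2 * (iteratedDerivWithin 2 f (Icc 0 1) y / derivWithin f (Icc 0 1) y) ^ 2

/-- The transverse Lyapunov exponent of the boundary circle `(ℝ/ℤ) × {c}`, `c = 0, 1`, of the
cylinder: the mean of `log (∂f_x/∂y)(c)` over the circle. -/
def transverseLyap (f : UnitAddCircle → ℝ → ℝ) (c : ℝ) : ℝ :=
  ∫ x : UnitAddCircle, Real.log (derivWithin (f x) (Icc 0 1) c)

/-- `ν` is an asymptotic measure of `F`: a probability measure such that Lebesgue almost every
orbit is uniformly distributed with respect to `ν`. -/
def IsAsymptoticMeasure (F : Cylinder → Cylinder) (ν : Measure Cylinder) : Prop :=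
  IsProbabilityMeasure ν ∧
    ∀ᵐ z ∂(volume : Measure Cylinder), ∀ χ : C(Cylinder, ℝ),
      Tendsto (fun n : ℕ => (∑ i ∈ Finset.range n, χ (F^[i] z)) / (n : ℝ)) atTop
        (𝓝 (∫ w, χ w ∂ν))

/-- The `j`-th branch `(x,y) ↦ (x', y + ε cos(2πx') y (1-y))`, `x' = (x+j)/k`, of the inverse of
the cylinder map, in the universal cover. -/
def inverseBranch (k : ℕ) (ε : ℝ) (j : ℕ) (z : ℝ × ℝ) : ℝ × ℝ :=
  ((z.1 + j) / k,
    z.2 + ε * Real.cos (2 * Real.pi * ((z.1 + j) / k)) * z.2 * (1 - z.2))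

end

/-! The equation `kanQ a u = y` is quadratic, so each fibre map has a closed form. Its derivative is
the power −1/2 of `kanDisc`, which is affine in `y`; this gives smoothness and the Schwarzian
`6a²/D²`. The transverse exponents are the means of `-log(1 ± p)`, which are positive because
`-log(1 + t) ≥ -t`, strictly for `t ≠ 0`, and `p` has mean zero.

Invariance: the inverse branches have Jacobians `(1 + p(x')(1 - 2y))/k`, and `p` sums to zero over
the `k` preimages `x'` of a point of the circle (`sum_cos_add_two_pi_mul_div`).

Ergodicity is a Hopf argument along the fibres. In the coordinate `logOdds` the map `kanQ a`
expands, with a gain of at least `a²/4 · |u - v|` (`abs_logOdds_sub_add_le`). Hence for two orbits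
in common fibres the series of `p(xₙ)² |yₙ₊₁ - yₙ₊₁'|` converges. Since `p ≠ 0` almost everywhere
and `xₙ` is always Lebesgue distributed, such orbits approach each other in the mean
(`tendsto_integral_abs_observable_sub`). An invariant function, approximated in `L¹` by continuous
ones, is therefore constant on almost every fibre (`ae_eq_of_comp_eq`) and descends to the circle,
where `x ↦ kx` is ergodic. Birkhoff's theorem along a dense sequence of observables then gives
uniform distribution. -/

noncomputable section

/-! ### Birkhoff's ergodic theorem by running maxima -/

/-- The running maximum `max (0, S₁, …, Sₙ)` of the Birkhoff sums of `f` along `T`. -/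
def birkhoffMax {α : Type*} (T : α → α) (f : α → ℝ) : ℕ → α → ℝ
  | 0, _ => 0
  | n + 1, x => max 0 (f x + birkhoffMax T f n (T x))

section BirkhoffMax

variable {α : Type*} (T : α → α) (f : α → ℝ)

theorem birkhoffMax_nonneg (n : ℕ) (x : α) : 0 ≤ birkhoffMax T f n x := by
  cases n with
  | zero => exact le_rfl
  | succ n => exact le_max_left _ _

theorem birkhoffMax_le_succ (n : ℕ) (x : α) : birkhoffMax T f n x ≤ birkhoffMax T f (n + 1) x := by
  induction n generalizing x with
  | zero => exact le_max_left _ _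
  | succ n ih =>
    have := ih (T x)
    simp only [birkhoffMax] at this ⊢
    gcongr

theorem birkhoffMax_mono (x : α) : Monotone fun n => birkhoffMax T f n x :=
  monotone_nat_of_le_succ fun n => birkhoffMax_le_succ T f n x

theorem birkhoffSum_le_birkhoffMax (n : ℕ) (x : α) :
    birkhoffSum T f n x ≤ birkhoffMax T f n x := by
  induction n generalizing x with
  | zero => simp [birkhoffMax]
  | succ n ih =>
    rw [birkhoffSum_succ', birkhoffMax]
    exact le_max_of_le_right (by linarith [ih (T x)])

/-- The recursion `M (n+1) = max 0 (f + M n ∘ T)` bounds either sequence in terms of the other. So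
the set where the maxima stay bounded is exactly invariant, as ergodicity requires. -/
theorem bddAbove_birkhoffMax_comp_iff (x : α) :
    BddAbove (range fun n => birkhoffMax T f n (T x)) ↔
      BddAbove (range fun n => birkhoffMax T f n x) := by
  constructor
  · rintro ⟨C, hC⟩
    refine ⟨max 0 (f x + C), ?_⟩
    rintro _ ⟨n, rfl⟩
    refine (birkhoffMax_le_succ T f n x).trans ?_
    have : birkhoffMax T f n (T x) ≤ C := hC ⟨n, rfl⟩
    simp only [birkhoffMax]
    gcongr
  · rintro ⟨C, hC⟩
    refine ⟨C - f x, ?_⟩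
    rintro _ ⟨n, rfl⟩
    have h1 : birkhoffMax T f (n + 1) x ≤ C := hC ⟨n + 1, rfl⟩
    have h2 : f x + birkhoffMax T f n (T x) ≤ birkhoffMax T f (n + 1) x := le_max_right _ _
    show birkhoffMax T f n (T x) ≤ C - f x
    linarith

variable [MeasurableSpace α] {T f}

theorem measurable_birkhoffMax (hT : Measurable T) (hf : Measurable f) (n : ℕ) :
    Measurable (birkhoffMax T f n) := by
  induction n with
  | zero => exact measurable_const
  | succ n ih => exact measurable_const.max (hf.add (ih.comp hT))

theorem integrable_birkhoffMax {μ : Measure α} [IsFiniteMeasure μ] (hT : MeasurePreserving T μ μ)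
    (hf : Integrable f μ) (n : ℕ) : Integrable (birkhoffMax T f n) μ := by
  induction n with
  | zero => exact integrable_const 0
  | succ n ih =>
    have := (integrable_const (0 : ℝ)).sup (hf.add (hT.integrable_comp_of_integrable ih))
    exact this

/-- If `∫ f < 0` and `T` is ergodic, the Birkhoff sums of `f` are almost everywhere bounded above. -/
theorem Ergodic.ae_bddAbove_birkhoffMax {μ : Measure α} [IsProbabilityMeasure μ]
    (hT : Ergodic T μ) (hfm : Measurable f) (hf : Integrable f μ) (hneg : ∫ x, f x ∂μ < 0) :
    ∀ᵐ x ∂μ, BddAbove (range fun n => birkhoffMax T f n x) := by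
  have hTm := hT.toMeasurePreserving
  have hM := measurable_birkhoffMax hTm.measurable hfm
  have hMi := integrable_birkhoffMax hTm hf
  have hA : MeasurableSet {x | BddAbove (range fun n => birkhoffMax T f n x)} :=
    measurableSet_bddAbove_range hM
  rcases hT.toPreErgodic.ae_mem_or_ae_notMem hA
    (by ext x; exact bddAbove_birkhoffMax_comp_iff T f x) with h | h
  · exact h
  exfalso
  -- The difference is `max (-M n (T x)) (f x)`. It is dominated by `|f x|`, and where the maxima
  -- are unbounded it equals `f x` for all large `n`. Since `M` increases and `T` preserves `μ`, its
  -- integrals are nonnegative, against `∫ f < 0`.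
  have hlim : Tendsto (fun n => ∫ x, (birkhoffMax T f (n + 1) x - birkhoffMax T f n (T x)) ∂μ)
      atTop (𝓝 (∫ x, f x ∂μ)) := by
    refine tendsto_integral_of_dominated_convergence (fun x => |f x|) (fun n => ?_) hf.abs
      (fun n => .of_forall fun x => ?_) ?_
    · exact ((hM _).sub ((hM n).comp hTm.measurable)).aestronglyMeasurable
    · have h0 := birkhoffMax_nonneg T f n (T x)
      rw [birkhoffMax, Real.norm_eq_abs, abs_le]
      constructor
      · linarith [neg_abs_le (f x), le_max_right 0 (f x + birkhoffMax T f n (T x))]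
      · rw [sub_le_iff_le_add]
        exact max_le (by positivity) (by linarith [le_abs_self (f x)])
    · filter_upwards [h] with x hx
      have hx' : ¬ BddAbove (range fun n => birkhoffMax T f n (T x)) :=
        (bddAbove_birkhoffMax_comp_iff T f x).not.mpr hx
      have ht := (tendsto_atTop_atTop_of_monotone' (birkhoffMax_mono T f (T x)) hx')
      refine tendsto_const_nhds.congr' ?_
      filter_upwards [ht.eventually_ge_atTop (-f x)] with n hn
      rw [birkhoffMax, max_eq_right (by linarith)]
      ring
  have hnn : ∀ n, 0 ≤ ∫ x, (birkhoffMax T f (n + 1) x - birkhoffMax T f n (T x)) ∂μ := by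
    intro n
    have h1 : ∫ x, birkhoffMax T f n (T x) ∂μ = ∫ x, birkhoffMax T f n x ∂μ := by
      have := integral_map hTm.measurable.aemeasurable
        (hM n).aestronglyMeasurable (μ := μ)
      rw [hTm.map_eq] at this
      exact this.symm
    have h2 : Integrable (fun x => birkhoffMax T f n (T x)) μ :=
      hTm.integrable_comp_of_integrable (hMi n)
    rw [integral_sub (hMi _) h2, h1, sub_nonneg]
    exact integral_mono (hMi _) (hMi _) fun x => birkhoffMax_le_succ T f n x
  exact absurd (ge_of_tendsto' hlim hnn) (not_le.mpr hneg)

theorem Ergodic.ae_eventually_birkhoffSum_div_lt {μ : Measure α} [IsProbabilityMeasure μ]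
    (hT : Ergodic T μ) (hfm : Measurable f) (hf : Integrable f μ) {c : ℝ}
    (hc : ∫ x, f x ∂μ < c) :
    ∀ᵐ x ∂μ, ∀ᶠ n : ℕ in atTop, birkhoffSum T f n x / n < c := by
  -- The sums of `f - b` are bounded by some `C`, so the averages of `f` are at most `b + C/n`; the
  -- gap `c - b` absorbs `C/n`.
  obtain ⟨b, hb, hbc⟩ := exists_between hc
  have hneg : ∫ x, (f x - b) ∂μ < 0 := by
    rw [integral_sub hf (integrable_const b)]
    simpa using hb
  filter_upwards [hT.ae_bddAbove_birkhoffMax (hfm.sub_const b) (hf.sub (integrable_const b)) hneg]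
    with x hx
  obtain ⟨C, hC⟩ := hx
  have h1 : Tendsto (fun n : ℕ => C / (n : ℝ)) atTop (𝓝 0) :=
    tendsto_const_div_atTop_nhds_zero_nat C
  filter_upwards [h1.eventually_lt_const (sub_pos.mpr hbc), eventually_gt_atTop 0] with n hn hn0
  have hn0' : (0 : ℝ) < n := by exact_mod_cast hn0
  have h2 := (birkhoffSum_le_birkhoffMax T (fun x => f x - b) n x).trans (hC ⟨n, rfl⟩)
  have h3 : birkhoffSum T (fun x => f x - b) n x = birkhoffSum T f n x - n * b := by
    simp [birkhoffSum, Finset.sum_sub_distrib]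
  rw [h3] at h2
  rw [div_lt_iff₀ hn0'] at hn ⊢
  linarith

/-- **Birkhoff's pointwise ergodic theorem** for an ergodic transformation. -/
theorem Ergodic.ae_tendsto_birkhoffSum_div {μ : Measure α} [IsProbabilityMeasure μ]
    (hT : Ergodic T μ) (hfm : Measurable f) (hf : Integrable f μ) :
    ∀ᵐ x ∂μ, Tendsto (fun n : ℕ => birkhoffSum T f n x / n) atTop (𝓝 (∫ x, f x ∂μ)) := by
  have key : ∀ g : α → ℝ, Measurable g → Integrable g μ → ∀ᵐ x ∂μ, ∀ m : ℕ,
      ∀ᶠ n : ℕ in atTop, birkhoffSum T g n x / n < ∫ x, g x ∂μ + 1 / ((m : ℝ) + 1) := by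
    intro g hgm hg
    rw [ae_all_iff]
    intro m
    exact hT.ae_eventually_birkhoffSum_div_lt hgm hg
      (lt_add_of_pos_right _ Nat.one_div_pos_of_nat)
  filter_upwards [key f hfm hf, key (fun x => -f x) hfm.neg hf.neg] with x h1 h2
  rw [Metric.tendsto_atTop']
  intro e he
  obtain ⟨m, hm⟩ := exists_nat_one_div_lt he
  have h3 : ∀ n, birkhoffSum T (fun x => -f x) n x = -birkhoffSum T f n x := by
    intro n; simp [birkhoffSum]
  have := (h1 m).and (h2 m)
  rw [eventually_atTop] at this
  obtain ⟨N, hN⟩ := this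
  refine ⟨N, fun n hn => ?_⟩
  obtain ⟨h4, h5⟩ := hN n hn.le
  rw [h3, neg_div, integral_neg] at h5
  rw [Real.dist_eq, abs_lt]
  constructor <;> linarith

end BirkhoffMax

/-! ### Closed form of the fibre maps and their Schwarzian -/

/-- The discriminant of the quadratic equation `kanQ a u = y`. -/
def kanDisc (a y : ℝ) : ℝ := (1 + a) ^ 2 - 4 * a * y

section Fibre

variable {a : ℝ}

/-- As an affine function of `y`, the discriminant interpolates between `(1 + a)²` at 0 and `(1 -
a)²` at 1. -/
theorem kanDisc_pos (ha : |a| < 1) {y : ℝ} (hy : y ∈ Icc (0 : ℝ) 1) : 0 < kanDisc a y := by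
  obtain ⟨h1, h2⟩ := abs_lt.mp ha
  have e : kanDisc a y = (1 + a) ^ 2 * (1 - y) + (1 - a) ^ 2 * y := by unfold kanDisc; ring
  rw [e]
  rcases hy.1.eq_or_lt with h | h
  · rw [← h]
    have : 0 < 1 + a := by linarith
    simp only [sub_zero, mul_one, mul_zero, add_zero]
    positivity
  · have h3 : 0 < 1 - a := by linarith
    have := mul_nonneg (sq_nonneg (1 + a)) (sub_nonneg.mpr hy.2)
    positivity

theorem kanQ_kanQInv (ha : |a| < 1) {y : ℝ} (hy : y ∈ Icc (0 : ℝ) 1) :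
    kanQ a (kanQInv a y) = y :=
  (kanQInv_invOn ha).2 hy

theorem kanQInv_kanQ (ha : |a| < 1) {y : ℝ} (hy : y ∈ Icc (0 : ℝ) 1) :
    kanQInv a (kanQ a y) = y :=
  (kanQInv_invOn ha).1 hy

theorem kanQ_mem (ha : |a| < 1) {y : ℝ} (hy : y ∈ Icc (0 : ℝ) 1) : kanQ a y ∈ Icc (0 : ℝ) 1 :=
  (kanQ_bijOn ha).mapsTo hy

theorem kanQ_deriv_pos (ha : |a| < 1) {y : ℝ} (hy : y ∈ Icc (0 : ℝ) 1) :
    0 < 1 + a * (1 - 2 * y) := by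
  obtain ⟨h1, h2⟩ := abs_lt.mp ha
  have h3 := mul_nonneg (by linarith : 0 ≤ 1 + a) (sub_nonneg.mpr hy.2)
  have h4 := mul_nonneg (by linarith : 0 ≤ 1 - a) hy.1
  have e : 1 + a * (1 - 2 * y) = (1 + a) * (1 - y) + (1 - a) * y := by ring
  rcases hy.1.eq_or_lt with h | h
  · rw [← h]; linarith
  · have := mul_pos (by linarith : 0 < 1 - a) h
    linarith

/-- The solution `2 y / (1 + a + √D)` of `kanQ a u = y`. -/
theorem kanQInv_eq (ha : |a| < 1) {y : ℝ} (hy : y ∈ Icc (0 : ℝ) 1) :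
    kanQInv a y = 2 * y / (1 + a + √(kanDisc a y)) := by
  set u := kanQInv a y with hu
  have hum : u ∈ Icc (0 : ℝ) 1 := kanQInv_mem ha hy
  have hq : kanQ a u = y := kanQ_kanQInv ha hy
  have hpos := kanQ_deriv_pos ha hum
  -- At `y = kanQ a u` the discriminant is the square of the derivative of `kanQ a` at `u`, which is
  -- positive. Keeping the root in the denominator makes the formula valid for `a = 0` too.
  have hD : kanDisc a y = (1 + a * (1 - 2 * u)) ^ 2 := by
    rw [← hq]; unfold kanDisc kanQ; ring
  have h1 : 0 < 1 + a := by linarith [(abs_lt.mp ha).1]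
  rw [hD, Real.sqrt_sq hpos.le, eq_div_iff (by linarith), ← hq]
  unfold kanQ; ring

theorem hasDerivAt_sqrt_kanDisc {y : ℝ} (h : 0 < kanDisc a y) :
    HasDerivAt (fun y => √(kanDisc a y)) (-2 * a / √(kanDisc a y)) y := by
  have h1 : HasDerivAt (kanDisc a) (-(4 * a)) y := by
    have := ((hasDerivAt_id y).const_mul (4 * a)).const_sub ((1 + a) ^ 2)
    rw [mul_one] at this
    exact this
  refine (h1.sqrt h.ne').congr_deriv ?_
  have := Real.sqrt_pos.mpr h
  field_simp
  ring

theorem hasDerivAt_inv_sqrt_kanDisc {y : ℝ} (h : 0 < kanDisc a y) :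
    HasDerivAt (fun y => (√(kanDisc a y))⁻¹) (2 * a * ((√(kanDisc a y))⁻¹) ^ 3) y := by
  have hs := Real.sqrt_pos.mpr h
  refine ((hasDerivAt_sqrt_kanDisc h).inv hs.ne').congr_deriv ?_
  field_simp

theorem hasDerivWithinAt_kanQInv (ha : |a| < 1) {y : ℝ} (hy : y ∈ Icc (0 : ℝ) 1) :
    HasDerivWithinAt (kanQInv a) (√(kanDisc a y))⁻¹ (Icc 0 1) y := by
  have hD := kanDisc_pos ha hy
  have hs := Real.sqrt_pos.mpr hD
  have h1 : 0 < 1 + a := by linarith [(abs_lt.mp ha).1]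
  have key : HasDerivAt (fun y => 2 * y / (1 + a + √(kanDisc a y))) (√(kanDisc a y))⁻¹ y := by
    refine (((hasDerivAt_id y).const_mul 2).div
      ((hasDerivAt_sqrt_kanDisc hD).const_add (1 + a)) (by positivity)).congr_deriv ?_
    have h2 : √(kanDisc a y) ^ 2 = (1 + a) ^ 2 - 4 * a * y := Real.sq_sqrt hD.le
    simp only [id]
    field_simp
    linear_combination h2
  exact key.hasDerivWithinAt.congr (fun z hz => kanQInv_eq ha hz) (kanQInv_eq ha hy)

theorem contDiffOn_kanQInv (ha : |a| < 1) : ContDiffOn ℝ ∞ (kanQInv a) (Icc 0 1) := by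
  have h1 : 0 < 1 + a := by linarith [(abs_lt.mp ha).1]
  have key : ContDiffOn ℝ ∞ (fun y => 2 * y / (1 + a + √(kanDisc a y))) (Icc 0 1) := by
    refine ContDiffOn.div (by fun_prop) (contDiffOn_const.add (ContDiffOn.sqrt ?_ ?_)) ?_
    · unfold kanDisc; fun_prop
    · exact fun y hy => (kanDisc_pos ha hy).ne'
    · intro y hy
      have := Real.sqrt_pos.mpr (kanDisc_pos ha hy)
      positivity
  exact key.congr fun z hz => kanQInv_eq ha hz

theorem bijOn_kanQInv (ha : |a| < 1) : BijOn (kanQInv a) (Icc 0 1) (Icc 0 1) :=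
  (kanQInv_invOn ha).symm.bijOn (fun _ hy => kanQInv_mem ha hy) (kanQ_bijOn ha).mapsTo

theorem derivWithin_kanQInv (ha : |a| < 1) {y : ℝ} (hy : y ∈ Icc (0 : ℝ) 1) :
    derivWithin (kanQInv a) (Icc 0 1) y = (√(kanDisc a y))⁻¹ :=
  (hasDerivWithinAt_kanQInv ha hy).derivWithin (uniqueDiffOn_Icc_zero_one y hy)

theorem iteratedDerivWithin_two_kanQInv (ha : |a| < 1) {y : ℝ} (hy : y ∈ Icc (0 : ℝ) 1) :
    iteratedDerivWithin 2 (kanQInv a) (Icc 0 1) y = 2 * a * ((√(kanDisc a y))⁻¹) ^ 3 := by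
  rw [iteratedDerivWithin_succ, iteratedDerivWithin_one,
    derivWithin_congr (fun z hz => derivWithin_kanQInv ha hz) (derivWithin_kanQInv ha hy)]
  exact (hasDerivAt_inv_sqrt_kanDisc (kanDisc_pos ha hy)).hasDerivWithinAt.derivWithin
    (uniqueDiffOn_Icc_zero_one y hy)

theorem iteratedDerivWithin_three_kanQInv (ha : |a| < 1) {y : ℝ} (hy : y ∈ Icc (0 : ℝ) 1) :
    iteratedDerivWithin 3 (kanQInv a) (Icc 0 1) y = 12 * a ^ 2 * ((√(kanDisc a y))⁻¹) ^ 5 := by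
  rw [iteratedDerivWithin_succ,
    derivWithin_congr (fun z hz => iteratedDerivWithin_two_kanQInv ha hz)
      (iteratedDerivWithin_two_kanQInv ha hy)]
  refine HasDerivWithinAt.derivWithin (HasDerivAt.hasDerivWithinAt ?_)
    (uniqueDiffOn_Icc_zero_one y hy)
  refine (((hasDerivAt_inv_sqrt_kanDisc (kanDisc_pos ha hy)).pow 3).const_mul (2 * a)).congr_deriv ?_
  push_cast
  ring

/-- With `D = kanDisc a y` the three derivatives are `D^(-1/2)`, `2a D^(-3/2)` and `12a² D^(-5/2)`,
so the Schwarzian is `12a²/D² - 6a²/D²`. -/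
theorem schwarzian_kanQInv_pos (ha : |a| < 1) (h0 : a ≠ 0) {y : ℝ} (hy : y ∈ Icc (0 : ℝ) 1) :
    0 < schwarzian (kanQInv a) y := by
  have hs := Real.sqrt_pos.mpr (kanDisc_pos ha hy)
  have : schwarzian (kanQInv a) y = 6 * a ^ 2 * ((√(kanDisc a y))⁻¹) ^ 4 := by
    rw [schwarzian, iteratedDerivWithin_two_kanQInv ha hy, iteratedDerivWithin_three_kanQInv ha hy,
      derivWithin_kanQInv ha hy]
    field_simp
    ring
  rw [this]
  positivity

end Fibre

/-! ### The function `p` and the transverse Lyapunov exponents -/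

theorem continuous_kanP (ε : ℝ) : Continuous (kanP ε) :=
  continuous_coinduced_dom.mpr
    (by fun_prop : Continuous fun t : ℝ => ε * Real.cos (2 * Real.pi * t))

theorem kanP_neg (ε : ℝ) (x : UnitAddCircle) : kanP (-ε) x = -kanP ε x := by
  induction x using QuotientAddGroup.induction_on with
  | H t => exact neg_mul _ _

theorem integral_kanP (ε : ℝ) : ∫ x : UnitAddCircle, kanP ε x = 0 := by
  rw [← UnitAddCircle.intervalIntegral_preimage 0]
  simp only [kanP_coe, intervalIntegral.integral_const_mul]
  rw [intervalIntegral.integral_comp_mul_left (fun t => Real.cos t) (by positivity)]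
  simp

theorem countable_setOf_mul_cos_eq_zero {ε : ℝ} (hε : ε ≠ 0) :
    {t : ℝ | ε * Real.cos (2 * Real.pi * t) = 0}.Countable := by
  refine (countable_range fun m : ℤ => ((2 * m + 1) / 4 : ℝ)).mono ?_
  intro t h
  obtain ⟨m, hm⟩ := Real.cos_eq_zero_iff.mp ((mul_eq_zero.mp h).resolve_left hε)
  refine ⟨m, ?_⟩
  have := Real.pi_pos
  field_simp at hm ⊢
  linarith

theorem ae_kanP_ne_zero {ε : ℝ} (hε : ε ≠ 0) : ∀ᵐ x : UnitAddCircle, kanP ε x ≠ 0 := by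
  have hm : MeasurableSet {x : UnitAddCircle | kanP ε x = 0} :=
    (isClosed_singleton.preimage (continuous_kanP ε)).measurableSet
  have h : volume {x : UnitAddCircle | kanP ε x = 0} = 0 := by
    rw [← (UnitAddCircle.measurePreserving_mk 0).measure_preimage hm.nullMeasurableSet]
    exact (countable_setOf_mul_cos_eq_zero hε).measure_zero _
  rw [ae_iff]
  simpa only [ne_eq, not_not] using h

/-- Adding `p`, of mean zero, makes the integrand nonnegative, and positive at `x = 0`, where `p = ε
≠ 0`. Either sign of `ε` is admitted because the boundary `y = 1` leads to `-log(1 - p)`, the case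
of `-ε`. -/
theorem integral_neg_log_one_add_kanP_pos {ε : ℝ} (h0 : ε ≠ 0)
    (h1 : ∀ x, |kanP ε x| < 1) : 0 < ∫ x : UnitAddCircle, -Real.log (1 + kanP ε x) := by
  have hpos : ∀ x, 0 < 1 + kanP ε x := fun x => by linarith [(abs_lt.mp (h1 x)).1]
  have hp := continuous_kanP ε
  have hc : Continuous fun x => -Real.log (1 + kanP ε x) :=
    ((continuous_const.add hp).log fun x => (hpos x).ne').neg
  have e : ∫ x : UnitAddCircle, -Real.log (1 + kanP ε x)
      = ∫ x : UnitAddCircle, (-Real.log (1 + kanP ε x) + kanP ε x) := by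
    rw [integral_add (hc.integrable_of_hasCompactSupport (.of_compactSpace _))
      (hp.integrable_of_hasCompactSupport (.of_compactSpace _)), integral_kanP, add_zero]
  rw [e]
  refine (hc.add hp).integral_pos_of_hasCompactSupport_nonneg_nonzero (.of_compactSpace _)
    (fun x => ?_) (x := ((0 : ℝ) : UnitAddCircle)) ?_
  · have := Real.log_le_sub_one_of_pos (hpos x)
    simp only [Pi.zero_apply]
    linarith
  · have h2 : kanP ε ((0 : ℝ) : UnitAddCircle) = ε := by rw [kanP_coe]; simp
    have h3 := hpos ((0 : ℝ) : UnitAddCircle)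
    rw [h2] at h3 ⊢
    have := Real.log_lt_sub_one_of_pos h3 (by simpa using h0)
    linarith

theorem transverseLyap_kanFiber_zero_pos {ε : ℝ} (h0 : 0 < ε) (h1 : ε < 1) :
    0 < transverseLyap (kanFiber ε) 0 := by
  have ha := abs_kanP_lt_one h0 h1
  convert integral_neg_log_one_add_kanP_pos h0.ne' ha using 1
  refine integral_congr_ae (.of_forall fun x => ?_)
  have hpos : 0 < 1 + kanP ε x := by linarith [(abs_lt.mp (ha x)).1]
  simp only [kanFiber]
  rw [derivWithin_kanQInv (ha x) (by simp), Real.log_inv, kanDisc, mul_zero, sub_zero,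
    Real.sqrt_sq hpos.le]

theorem transverseLyap_kanFiber_one_pos {ε : ℝ} (h0 : 0 < ε) (h1 : ε < 1) :
    0 < transverseLyap (kanFiber ε) 1 := by
  have ha := abs_kanP_lt_one h0 h1
  convert integral_neg_log_one_add_kanP_pos (neg_ne_zero.mpr h0.ne')
    (fun x => by rw [kanP_neg, abs_neg]; exact ha x) using 1
  refine integral_congr_ae (.of_forall fun x => ?_)
  have hpos : 0 < 1 - kanP ε x := by linarith [(abs_lt.mp (ha x)).2]
  have e : kanDisc (kanP ε x) 1 = (1 - kanP ε x) ^ 2 := by unfold kanDisc; ring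
  simp only [kanFiber]
  rw [derivWithin_kanQInv (ha x) (by simp), Real.log_inv, e, Real.sqrt_sq hpos.le, kanP_neg,
    sub_eq_add_neg]

theorem continuous_cylinderMap_kanFiber {ε : ℝ} (h0 : 0 < ε) (h1 : ε < 1) (k : ℕ) :
    Continuous (cylinderMap k (kanFiber ε)) := by
  have ha := abs_kanP_lt_one h0 h1
  refine Continuous.prodMk ((continuous_nsmul k).comp continuous_fst) (continuous_projIcc.comp ?_)
  have e : (fun z : Cylinder => kanFiber ε z.1 z.2) = fun z : Cylinder =>
      2 * (z.2 : ℝ) / (1 + kanP ε z.1 + √(kanDisc (kanP ε z.1) z.2)) :=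
    funext fun z => kanQInv_eq (ha z.1) z.2.2
  rw [e]
  have hp : Continuous fun z : Cylinder => kanP ε z.1 := (continuous_kanP ε).comp continuous_fst
  refine Continuous.div (by fun_prop) ?_ fun z => ?_
  · unfold kanDisc; fun_prop
  · have h2 := (abs_lt.mp (ha z.1)).1
    have h3 := Real.sqrt_pos.mpr (kanDisc_pos (ha z.1) z.2.2)
    linarith

/-! ### Inverse branches and their Jacobians -/

section Branches

/-- The sum is the real part of `exp(iθ)` times the sum of all `k`-th roots of unity. -/
theorem sum_cos_add_two_pi_mul_div {k : ℕ} (hk : 2 ≤ k) (θ : ℝ) :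
    ∑ j ∈ Finset.range k, Real.cos (θ + 2 * Real.pi * (j / k)) = 0 := by
  have hζ := (Complex.isPrimitiveRoot_exp k (by omega)).geom_sum_eq_zero (by omega)
  have h : ∀ j : ℕ, Real.cos (θ + 2 * Real.pi * (j / k)) =
      (Complex.exp (θ * Complex.I) * Complex.exp (2 * Real.pi * Complex.I / k) ^ j).re := by
    intro j
    rw [← Complex.exp_nat_mul, ← Complex.exp_add, ← Complex.exp_ofReal_mul_I_re]
    congr 2
    push_cast
    ring
  simp_rw [h]
  rw [← Complex.re_sum, ← Finset.mul_sum, hζ]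
  simp

theorem sum_cos_two_pi_mul_add_div {k : ℕ} (hk : 2 ≤ k) (x : ℝ) :
    ∑ j ∈ Finset.range k, Real.cos (2 * Real.pi * ((x + j) / k)) = 0 := by
  rw [← sum_cos_add_two_pi_mul_div hk (2 * Real.pi * (x / k))]
  refine Finset.sum_congr rfl fun j _ => ?_
  congr 1
  ring

theorem toCylinder_inverseBranch (k : ℕ) (ε : ℝ) (j : ℕ) (x y : ℝ) :
    toCylinder (inverseBranch k ε j (x, y)) = ((((x + j) / k : ℝ) : UnitAddCircle),
      Set.projIcc 0 1 zero_le_one (kanQ (kanP ε (((x + j) / k : ℝ) : UnitAddCircle)) y)) := rfl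

theorem nsmul_coe_div {k : ℕ} (hk : k ≠ 0) (x : ℝ) :
    k • ((x / k : ℝ) : UnitAddCircle) = (x : UnitAddCircle) := by
  rw [← AddCircle.coe_nsmul, nsmul_eq_mul, mul_div_cancel₀ _ (by exact_mod_cast hk)]

theorem coe_add_natCast (x : ℝ) (j : ℕ) : ((x + j : ℝ) : UnitAddCircle) = (x : UnitAddCircle) := by
  have : ((j : ℝ) : UnitAddCircle) = 0 := (AddCircle.coe_eq_zero_iff 1).mpr ⟨j, by simp⟩
  rw [AddCircle.coe_add, this, add_zero]

theorem coe_add_div_injOn {k : ℕ} (x : ℝ) :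
    InjOn (fun j : ℕ => (((x + j) / k : ℝ) : UnitAddCircle)) (Iio k) := by
  intro i hi j hj hij
  simp only [mem_Iio] at hi hj
  have hk : (0 : ℝ) < k := by exact_mod_cast (by omega : 0 < k)
  have h : (((x + i) / k - (x + j) / k : ℝ) : UnitAddCircle) = 0 := by
    rw [AddCircle.coe_sub, sub_eq_zero]; exact hij
  obtain ⟨n, hn⟩ := AddCircle.coe_eq_zero_iff 1 |>.mp h
  have h2 : ((n * k : ℤ) : ℝ) = ((i - j : ℤ) : ℝ) := by
    push_cast
    rw [zsmul_eq_mul, mul_one] at hn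
    rw [hn]
    field_simp
    ring
  have h3 : n * k = (i : ℤ) - j := by exact_mod_cast h2
  have h4 : n = 0 := by
    by_contra hne
    rcases lt_or_gt_of_ne hne with h | h
    · nlinarith
    · nlinarith
  rw [h4] at h3
  omega

theorem exists_eq_coe_add_div {k : ℕ} (hk : 0 < k) {x : ℝ} {w : UnitAddCircle}
    (hw : k • w = (x : UnitAddCircle)) :
    ∃ j < k, w = (((x + j : ℝ) / k : ℝ) : UnitAddCircle) := by
  induction w using QuotientAddGroup.induction_on with
  | H t =>
    have hk' : (0 : ℝ) < k := by exact_mod_cast hk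
    have hkz : (0 : ℤ) < k := by exact_mod_cast hk
    have h : ((k • t - x : ℝ) : UnitAddCircle) = 0 := by
      rw [AddCircle.coe_sub, sub_eq_zero]; exact hw
    obtain ⟨m, hm⟩ := AddCircle.coe_eq_zero_iff 1 |>.mp h
    rw [zsmul_eq_mul, mul_one, nsmul_eq_mul] at hm
    -- Here `k t = x + m`; reducing `m` modulo `k` changes `(x + m)/k` by the integer `m / k`.
    refine ⟨(m % k).toNat, ?_, ?_⟩
    · have := Int.emod_lt_of_pos m hkz
      omega
    · have h1 : (((m % k).toNat : ℕ) : ℝ) = ((m % k : ℤ) : ℝ) := by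
        have := Int.toNat_of_nonneg (Int.emod_nonneg m hkz.ne')
        exact_mod_cast congrArg (Int.cast : ℤ → ℝ) this
      have h2 : ((m % k : ℤ) : ℝ) + k * ((m / k : ℤ) : ℝ) = m := by
        exact_mod_cast Int.emod_add_mul_ediv m k
      change ((t : ℝ) : UnitAddCircle) = _
      rw [← sub_eq_zero, ← AddCircle.coe_sub, AddCircle.coe_eq_zero_iff]
      refine ⟨m / k, ?_⟩
      rw [zsmul_eq_mul, mul_one, h1]
      field_simp
      linarith

/-- The equation `k w = x` leaves `k` choices of `w`, and over each of them the height is forced to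
be `kanQ (kanP ε w) y`. -/
theorem bijOn_inverseBranch {k : ℕ} (hk : 0 < k) {ε : ℝ} (h0 : 0 < ε) (h1 : ε < 1) (x : ℝ)
    {y : ℝ} (hy : y ∈ Icc (0 : ℝ) 1) :
    BijOn (fun j : ℕ => toCylinder (inverseBranch k ε j (x, y))) (Iio k)
      (cylinderMap k (kanFiber ε) ⁻¹' {toCylinder (x, y)}) := by
  have ha := abs_kanP_lt_one h0 h1
  refine ⟨fun j _ => ?_, fun i hi j hj hij => ?_, ?_⟩
  · rw [mem_preimage, mem_singleton_iff]
    refine Prod.ext ?_ ?_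
    · exact (nsmul_coe_div hk.ne' _).trans (coe_add_natCast x j)
    · simp only [toCylinder_inverseBranch]
      rw [projIcc_of_mem _ (kanQ_mem (ha _) hy)]
      simp only [cylinderMap, toCylinder, kanFiber]
      rw [kanQInv_kanQ (ha _) hy]
  · exact coe_add_div_injOn x hi hj (congrArg Prod.fst hij)
  · rintro ⟨w, u⟩ hwu
    rw [mem_preimage, mem_singleton_iff] at hwu
    obtain ⟨j, hj, rfl⟩ := exists_eq_coe_add_div hk (congrArg Prod.fst hwu)
    refine ⟨j, hj, ?_⟩
    simp only [toCylinder_inverseBranch]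
    refine Prod.ext rfl ?_
    have h2 := congrArg (fun z : Cylinder => (z.2 : ℝ)) hwu
    simp only at h2
    rw [cylinderMap_kanFiber_snd h0 h1] at h2
    have h3 : ((toCylinder (x, y)).2 : ℝ) = y := by
      simp only [toCylinder]; rw [projIcc_of_mem _ hy]
    rw [h3] at h2
    simp only [kanFiber] at h2
    simp only
    rw [← h2, kanQ_kanQInv (ha _) u.2, projIcc_val]

theorem ContinuousLinearMap.det_prod_real (A : ℝ × ℝ →L[ℝ] ℝ × ℝ) :
    A.det = (A (1, 0)).1 * (A (0, 1)).2 - (A (0, 1)).1 * (A (1, 0)).2 := by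
  rw [ContinuousLinearMap.det, ← LinearMap.det_toMatrix (Module.Basis.finTwoProd ℝ),
    Matrix.det_fin_two]
  simp [LinearMap.toMatrix_apply]

/-- The first coordinate does not involve `y`, so the derivative is triangular with diagonal `1/k`
and the derivative of `kanQ`. -/
theorem hasFDerivAt_inverseBranch (k : ℕ) (ε : ℝ) (j : ℕ) (x y : ℝ) :
    ∃ A : ℝ × ℝ →L[ℝ] ℝ × ℝ, HasFDerivAt (inverseBranch k ε j) A (x, y) ∧
      A.det = (1 + ε * Real.cos (2 * Real.pi * ((x + j) / k)) * (1 - 2 * y)) / k := by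
  have hx : HasFDerivAt (fun z : ℝ × ℝ => z.1) (ContinuousLinearMap.fst ℝ ℝ ℝ) (x, y) :=
    hasFDerivAt_fst
  have hy : HasFDerivAt (fun z : ℝ × ℝ => z.2) (ContinuousLinearMap.snd ℝ ℝ ℝ) (x, y) :=
    hasFDerivAt_snd
  have h1 := (hx.add_const (j : ℝ)).mul_const ((k : ℝ)⁻¹)
  have h2 := (((h1.const_mul (2 * Real.pi)).cos).const_mul ε)
  have h3 := hy.add ((h2.mul hy).mul (hy.const_sub 1))
  refine ⟨_, h1.prodMk h3, ?_⟩
  rw [ContinuousLinearMap.det_prod_real]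
  simp [div_eq_mul_inv]
  ring

end Branches

/-! ### Invariance of Lebesgue measure -/

section Invariance

open scoped ENNReal

theorem lintegral_unitInterval (g : ℝ → ℝ≥0∞) :
    ∫⁻ y : unitInterval, g y = ∫⁻ y in Icc (0 : ℝ) 1, g y := by
  exact lintegral_subtype_comap measurableSet_Icc g

/-- Change of variables `u = kanQInv a y` in the unit interval. -/
theorem lintegral_comp_projIcc_kanQInv {a : ℝ} (ha : |a| < 1) (G : unitInterval → ℝ≥0∞) :
    ∫⁻ y : unitInterval, G (projIcc 0 1 zero_le_one (kanQInv a y)) =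
      ∫⁻ y : unitInterval, ENNReal.ofReal (1 + a * (1 - 2 * y)) * G y := by
  have hd : ∀ u ∈ Icc (0 : ℝ) 1,
      HasDerivWithinAt (kanQ a) (1 + a * (1 - 2 * u)) (Icc 0 1) u := by
    intro u _
    refine HasDerivAt.hasDerivWithinAt ?_
    have h := (hasDerivAt_id u).add
      (((hasDerivAt_id u).const_mul a).mul ((hasDerivAt_id u).const_sub 1))
    refine h.congr_deriv ?_
    simp only [id]
    ring
  have h := lintegral_image_eq_lintegral_abs_deriv_mul measurableSet_Icc hd
    (kanQ_strictMonoOn ha).injOn (fun y => G (projIcc 0 1 zero_le_one (kanQInv a y)))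
  rw [(kanQ_bijOn ha).image_eq] at h
  rw [lintegral_unitInterval fun y => G (projIcc 0 1 zero_le_one (kanQInv a y)), h,
    ← lintegral_subtype_comap measurableSet_Icc]
  refine lintegral_congr fun u => ?_
  rw [abs_of_pos (kanQ_deriv_pos ha u.2), kanQInv_kanQ ha u.2, projIcc_val]

/-- A weight on the circle whose average over the fibres of `x ↦ k x` is one
disappears when it is integrated against a function of `k x`. -/
theorem lintegral_mul_comp_nsmul {k : ℕ} (hk : 2 ≤ k) {w H : UnitAddCircle → ℝ≥0∞}
    (hw : Measurable w) (hH : Measurable H)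
    (hsum : ∀ x, ∑ j ∈ Finset.range k, w (x + ((j / k : ℝ) : UnitAddCircle)) = k) :
    ∫⁻ x, w x * H (k • x) = ∫⁻ x, H x := by
  have hm : MeasurePreserving (fun x : UnitAddCircle => k • x) volume volume :=
    (AddCircle.ergodic_nsmul hk).toMeasurePreserving
  have hk0 : k ≠ 0 := by omega
  -- Translation by `j/k` preserves Lebesgue measure and leaves `k • x` unchanged, so the weight can
  -- be averaged over all `j`.
  have h1 : ∀ j : ℕ, ∫⁻ x, w x * H (k • x) =
      ∫⁻ x, w (x + ((j / k : ℝ) : UnitAddCircle)) * H (k • x) := by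
    intro j
    rw [← lintegral_add_right_eq_self _ ((j / k : ℝ) : UnitAddCircle)]
    refine lintegral_congr fun x => ?_
    rw [nsmul_add, nsmul_coe_div hk0]
    have : ((j : ℝ) : UnitAddCircle) = 0 := by simpa using coe_add_natCast 0 j
    rw [this, add_zero]
  have h2 : (k : ℝ≥0∞) * ∫⁻ x, w x * H (k • x) = k * ∫⁻ x, H x := by
    calc (k : ℝ≥0∞) * ∫⁻ x, w x * H (k • x)
        = ∑ j ∈ Finset.range k, ∫⁻ x, w x * H (k • x) := by simp
      _ = ∑ j ∈ Finset.range k,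
            ∫⁻ x, w (x + ((j / k : ℝ) : UnitAddCircle)) * H (k • x) :=
          Finset.sum_congr rfl fun j _ => h1 j
      _ = ∫⁻ x, ∑ j ∈ Finset.range k,
            w (x + ((j / k : ℝ) : UnitAddCircle)) * H (k • x) := by
          rw [lintegral_finsetSum]
          exact fun j _ => (hw.comp (measurable_add_const _)).mul (hH.comp hm.measurable)
      _ = ∫⁻ x, k * H (k • x) := by simp_rw [← Finset.sum_mul, hsum]
      _ = k * ∫⁻ x, H (k • x) := lintegral_const_mul _ (hH.comp hm.measurable)
      _ = k * ∫⁻ x, H x := by rw [hm.lintegral_comp hH]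
  exact (ENNReal.mul_right_inj (by exact_mod_cast hk0) (by simp)).mp h2

theorem sum_kanP_add_div {k : ℕ} (hk : 2 ≤ k) (ε : ℝ) (x : UnitAddCircle) :
    ∑ j ∈ Finset.range k, kanP ε (x + ((j / k : ℝ) : UnitAddCircle)) = 0 := by
  induction x using QuotientAddGroup.induction_on with
  | H t =>
    have h : ∀ j : ℕ, kanP ε ((t : UnitAddCircle) + ((j / k : ℝ) : UnitAddCircle)) =
        ε * Real.cos (2 * Real.pi * t + 2 * Real.pi * (j / k)) := by
      intro j
      rw [← AddCircle.coe_add, kanP_coe, mul_add]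
    rw [Finset.sum_congr rfl fun j _ => h j, ← Finset.mul_sum, sum_cos_add_two_pi_mul_div hk,
      mul_zero]

/-- A change of variables in each fibre produces the weight `1 + p(x)(1 - 2y)`. After exchanging the
integrals `y` is fixed, and the weight averages to one over the preimages under `x ↦ k x`. -/
theorem measurePreserving_cylinderMap_kanFiber {k : ℕ} (hk : 2 ≤ k) {ε : ℝ} (h0 : 0 < ε)
    (h1 : ε < 1) :
    MeasurePreserving (cylinderMap k (kanFiber ε)) (volume : Measure Cylinder) volume := by
  have ha := abs_kanP_lt_one h0 h1
  have hF := (continuous_cylinderMap_kanFiber h0 h1 k).measurable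
  have hp := continuous_kanP ε
  refine ⟨hF, Measure.ext_of_lintegral _ fun g hg => ?_⟩
  rw [lintegral_map hg hF]
  have hk' : Continuous fun x : UnitAddCircle => k • x := continuous_nsmul k
  calc ∫⁻ z : Cylinder, g (cylinderMap k (kanFiber ε) z)
      = ∫⁻ x : UnitAddCircle, ∫⁻ y : unitInterval, g (cylinderMap k (kanFiber ε) (x, y)) :=
        lintegral_prod _ (hg.comp hF).aemeasurable
    _ = ∫⁻ x : UnitAddCircle, ∫⁻ y : unitInterval,
          ENNReal.ofReal (1 + kanP ε x * (1 - 2 * y)) * g (k • x, y) :=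
        lintegral_congr fun x => lintegral_comp_projIcc_kanQInv (ha x) fun u => g (k • x, u)
    _ = ∫⁻ y : unitInterval, ∫⁻ x : UnitAddCircle,
          ENNReal.ofReal (1 + kanP ε x * (1 - 2 * y)) * g (k • x, y) := by
        refine lintegral_lintegral_swap (Measurable.aemeasurable ?_)
        refine Measurable.mul ?_ (hg.comp ?_)
        · refine ENNReal.measurable_ofReal.comp (Continuous.measurable ?_)
          fun_prop
        · exact ((hk'.comp continuous_fst).prodMk continuous_snd).measurable
    _ = ∫⁻ y : unitInterval, ∫⁻ x : UnitAddCircle, g (x, y) := by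
        refine lintegral_congr fun y => ?_
        refine lintegral_mul_comp_nsmul hk
          (w := fun x => ENNReal.ofReal (1 + kanP ε x * (1 - 2 * y))) (H := fun x => g (x, y))
          ?_ (hg.comp (measurable_id.prodMk measurable_const)) fun x => ?_
        · refine ENNReal.measurable_ofReal.comp (Continuous.measurable ?_)
          fun_prop
        · rw [← ENNReal.ofReal_sum_of_nonneg fun j _ => (kanQ_deriv_pos (ha _) y.2).le,
            Finset.sum_add_distrib, ← Finset.sum_mul, sum_kanP_add_div hk]
          simp
    _ = ∫⁻ x : UnitAddCircle, ∫⁻ y : unitInterval, g (x, y) :=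
        lintegral_lintegral_swap
          (hg.comp (measurable_snd.prodMk measurable_fst)).aemeasurable
    _ = ∫⁻ z : Cylinder, g z := (lintegral_prod _ hg.aemeasurable).symm

end Invariance

/-! ### Contraction of the fibres in the log-odds metric -/

section Contraction

/-- The logarithm `log (y / (1 - y))` of the odds of `y`, a coordinate in which distances are
hyperbolic distances of the interval `(0,1)`. -/
def logOdds (y : ℝ) : ℝ := Real.log y - Real.log (1 - y)

variable {a : ℝ}

theorem kanQ_factors_pos (ha : |a| < 1) {u : ℝ} (hu : u ∈ Icc (0 : ℝ) 1) :
    0 < 1 + a * (1 - u) ∧ 0 < 1 - a * u := by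
  obtain ⟨h1, h2⟩ := abs_lt.mp ha
  have hb : ∀ t : ℝ, 0 ≤ t → t ≤ 1 → |a * t| < 1 := by
    intro t h0 h1
    rw [abs_mul, abs_of_nonneg h0]
    exact (mul_le_of_le_one_right (abs_nonneg a) h1).trans_lt ha
  have h3 := abs_lt.mp (hb (1 - u) (by linarith [hu.2]) (by linarith [hu.1]))
  have h4 := abs_lt.mp (hb u hu.1 hu.2)
  exact ⟨by linarith [h3.1], by linarith [h4.2]⟩

/-- Both `kanQ a u` and `1 - kanQ a u` factor, through `u` and `1 - u` respectively. -/
theorem logOdds_kanQ (ha : |a| < 1) {u : ℝ} (hu : u ∈ Ioo (0 : ℝ) 1) :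
    logOdds (kanQ a u) =
      logOdds u + (Real.log (1 + a * (1 - u)) - Real.log (1 - a * u)) := by
  obtain ⟨h1, h2⟩ := kanQ_factors_pos ha (Ioo_subset_Icc_self hu)
  have e1 : kanQ a u = u * (1 + a * (1 - u)) := by unfold kanQ; ring
  have e2 : 1 - kanQ a u = (1 - u) * (1 - a * u) := by unfold kanQ; ring
  have h3 : 0 < 1 - u := sub_pos.mpr hu.2
  rw [logOdds, e2, e1, Real.log_mul hu.1.ne' h1.ne', Real.log_mul h3.ne' h2.ne', logOdds]
  ring

/-- The map `kanQ a` expands the hyperbolic distance of `(0,1)`. -/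
theorem abs_logOdds_sub_add_le (ha : |a| < 1) {u v : ℝ} (hu : u ∈ Ioo (0 : ℝ) 1)
    (hv : v ∈ Ioo (0 : ℝ) 1) :
    |logOdds u - logOdds v| + a ^ 2 / 4 * |u - v| ≤
      |logOdds (kanQ a u) - logOdds (kanQ a v)| := by
  wlog huv : v ≤ u generalizing u v
  · rw [abs_sub_comm (logOdds u), abs_sub_comm u, abs_sub_comm (logOdds (kanQ a u))]
    exact this hv hu (le_of_not_ge huv)
  obtain ⟨h1, h2⟩ := kanQ_factors_pos ha (Ioo_subset_Icc_self hu)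
  obtain ⟨h3, h4⟩ := kanQ_factors_pos ha (Ioo_subset_Icc_self hv)
  have hmono : logOdds v ≤ logOdds u := by
    have := Real.log_le_log hv.1 huv
    have := Real.log_le_log (sub_pos.mpr hu.2) (by linarith : 1 - u ≤ 1 - v)
    unfold logOdds
    linarith
  -- The right side is `log (N/D)` with `N - D = a²(u - v)`. Then `log t ≥ 1 - 1/t` gives the bound
  -- `a²(u - v)/N`, and `N ≤ 4` since both of its factors are at most 2.
  have key : a ^ 2 / 4 * (u - v) ≤
      (Real.log (1 + a * (1 - u)) - Real.log (1 - a * u)) -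
        (Real.log (1 + a * (1 - v)) - Real.log (1 - a * v)) := by
    have hN : 0 < (1 + a * (1 - u)) * (1 - a * v) := mul_pos h1 h4
    have hD : 0 < (1 - a * u) * (1 + a * (1 - v)) := mul_pos h2 h3
    have hN4 : (1 + a * (1 - u)) * (1 - a * v) ≤ 4 := by
      obtain ⟨h5, h6⟩ := abs_lt.mp ha
      have h7 : a * (1 - u) ≤ 1 := by nlinarith [hu.1, hu.2]
      have h8 : -(a * v) ≤ 1 := by nlinarith [hv.1, hv.2]
      nlinarith
    have hlog := Real.one_sub_inv_le_log_of_pos (div_pos hN hD)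
    rw [Real.log_div hN.ne' hD.ne', Real.log_mul h1.ne' h4.ne', Real.log_mul h2.ne' h3.ne',
      inv_div] at hlog
    have e : 1 - (1 - a * u) * (1 + a * (1 - v)) / ((1 + a * (1 - u)) * (1 - a * v)) =
        a ^ 2 * (u - v) / ((1 + a * (1 - u)) * (1 - a * v)) := by
      rw [eq_div_iff hN.ne', sub_mul, div_mul_cancel₀ _ hN.ne']
      ring
    rw [e] at hlog
    have h9 : a ^ 2 * (u - v) / 4 ≤ a ^ 2 * (u - v) / ((1 + a * (1 - u)) * (1 - a * v)) :=
      div_le_div_of_nonneg_left (mul_nonneg (sq_nonneg a) (sub_nonneg.mpr huv)) hN hN4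
    linarith
  rw [abs_of_nonneg (sub_nonneg.mpr hmono), abs_of_nonneg (sub_nonneg.mpr huv),
    logOdds_kanQ ha hu, logOdds_kanQ ha hv]
  refine le_trans ?_ (le_abs_self _)
  linarith

theorem kanQInv_mem_Ioo (ha : |a| < 1) {y : ℝ} (hy : y ∈ Ioo (0 : ℝ) 1) :
    kanQInv a y ∈ Ioo (0 : ℝ) 1 := by
  have hyc := Ioo_subset_Icc_self hy
  have hm := kanQInv_mem ha hyc
  have hq := kanQ_kanQInv ha hyc
  refine ⟨hm.1.lt_of_ne fun h => ?_, hm.2.lt_of_ne fun h => ?_⟩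
  · rw [← h] at hq
    simp only [kanQ, mul_zero, zero_mul, add_zero] at hq
    linarith [hy.1]
  · rw [h] at hq
    simp only [kanQ, sub_self, mul_zero, add_zero] at hq
    linarith [hy.2]

theorem cylinderMap_snd_mem_Ioo {ε : ℝ} (h0 : 0 < ε) (h1 : ε < 1) (k : ℕ) {z : Cylinder}
    (hz : (z.2 : ℝ) ∈ Ioo (0 : ℝ) 1) :
    ((cylinderMap k (kanFiber ε) z).2 : ℝ) ∈ Ioo (0 : ℝ) 1 := by
  rw [cylinderMap_kanFiber_snd h0 h1]
  exact kanQInv_mem_Ioo (abs_kanP_lt_one h0 h1 z.1) hz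

/-- `F` contracts the hyperbolic distance of two points of a fibre. -/
theorem abs_logOdds_cylinderMap_add_le {ε : ℝ} (h0 : 0 < ε) (h1 : ε < 1) (k : ℕ)
    {z w : Cylinder} (hzw : z.1 = w.1) (hz : (z.2 : ℝ) ∈ Ioo (0 : ℝ) 1)
    (hw : (w.2 : ℝ) ∈ Ioo (0 : ℝ) 1) :
    |logOdds (cylinderMap k (kanFiber ε) z).2 - logOdds (cylinderMap k (kanFiber ε) w).2| +
      kanP ε z.1 ^ 2 / 4 *
        |((cylinderMap k (kanFiber ε) z).2 : ℝ) - (cylinderMap k (kanFiber ε) w).2| ≤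
      |logOdds z.2 - logOdds w.2| := by
  have ha := abs_kanP_lt_one h0 h1 z.1
  rw [cylinderMap_kanFiber_snd h0 h1, cylinderMap_kanFiber_snd h0 h1, ← hzw]
  simp only [kanFiber]
  have h := abs_logOdds_sub_add_le ha (kanQInv_mem_Ioo ha hz) (kanQInv_mem_Ioo ha hw)
  rwa [kanQ_kanQInv ha z.2.2, kanQ_kanQInv ha w.2.2] at h

/-- The distance of two orbits that start in the same fibre, weighted by `p(xₙ)²`, tends to zero. -/
theorem tendsto_kanP_sq_mul_abs_sub {ε : ℝ} (h0 : 0 < ε) (h1 : ε < 1) (k : ℕ)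
    {z w : Cylinder} (hzw : z.1 = w.1) (hz : (z.2 : ℝ) ∈ Ioo (0 : ℝ) 1)
    (hw : (w.2 : ℝ) ∈ Ioo (0 : ℝ) 1) :
    Tendsto (fun n : ℕ => kanP ε ((cylinderMap k (kanFiber ε))^[n] z).1 ^ 2 *
      |(((cylinderMap k (kanFiber ε))^[n + 1] z).2 : ℝ) -
        ((cylinderMap k (kanFiber ε))^[n + 1] w).2|) atTop (𝓝 0) := by
  set F := cylinderMap k (kanFiber ε) with hF
  have hinv : ∀ n : ℕ, (F^[n] z).1 = (F^[n] w).1 ∧ ((F^[n] z).2 : ℝ) ∈ Ioo (0 : ℝ) 1 ∧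
      ((F^[n] w).2 : ℝ) ∈ Ioo (0 : ℝ) 1 := by
    intro n
    induction n with
    | zero => exact ⟨hzw, hz, hw⟩
    | succ n ih =>
      rw [Function.iterate_succ_apply', Function.iterate_succ_apply']
      exact ⟨congrArg (k • ·) ih.1, cylinderMap_snd_mem_Ioo h0 h1 k ih.2.1,
        cylinderMap_snd_mem_Ioo h0 h1 k ih.2.2⟩
  -- The one-step losses telescope against the initial log-odds distance. The weight is taken at
  -- time `i` but the gap at time `i + 1`, since expansion is measured from the image back to its
  -- preimage under `kanQ`.
  have hsum : ∀ n : ℕ, |logOdds (F^[n] z).2 - logOdds (F^[n] w).2| +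
      ∑ i ∈ Finset.range n, kanP ε (F^[i] z).1 ^ 2 / 4 *
        |((F^[i + 1] z).2 : ℝ) - (F^[i + 1] w).2| ≤ |logOdds z.2 - logOdds w.2| := by
    intro n
    induction n with
    | zero => simp
    | succ n ih =>
      obtain ⟨i1, i2, i3⟩ := hinv n
      have := abs_logOdds_cylinderMap_add_le h0 h1 k i1 i2 i3
      rw [Finset.sum_range_succ]
      simp only [Function.iterate_succ_apply'] at ih ⊢
      linarith
  have hs : Summable fun i : ℕ => kanP ε (F^[i] z).1 ^ 2 / 4 *
      |((F^[i + 1] z).2 : ℝ) - (F^[i + 1] w).2| :=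
    summable_of_sum_range_le (fun n => by positivity) fun n =>
      (le_add_of_nonneg_left (abs_nonneg _)).trans (hsum n)
  have := hs.tendsto_atTop_zero.const_mul 4
  rw [mul_zero] at this
  refine this.congr fun n => ?_
  ring

theorem kanP_sq_le_one {ε : ℝ} (h0 : 0 < ε) (h1 : ε < 1) (x : UnitAddCircle) :
    kanP ε x ^ 2 ≤ 1 := by
  rw [← sq_abs]
  exact pow_le_one₀ (abs_nonneg _) (abs_kanP_lt_one h0 h1 x).le

theorem cylinderMap_iterate_fst_eq (k : ℕ) (f : UnitAddCircle → ℝ → ℝ) {z w : Cylinder}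
    (hzw : z.1 = w.1) (n : ℕ) :
    ((cylinderMap k f)^[n] z).1 = ((cylinderMap k f)^[n] w).1 := by
  induction n with
  | zero => exact hzw
  | succ n ih =>
    rw [Function.iterate_succ_apply', Function.iterate_succ_apply']
    exact congrArg (k • ·) ih

theorem ContinuousMap.exists_abs_le {X : Type*} [TopologicalSpace X] [CompactSpace X]
    (χ : C(X, ℝ)) : ∃ C : ℝ, 0 < C ∧ ∀ x, |χ x| ≤ C :=
  ⟨‖χ‖ + 1, by positivity, fun x => (χ.norm_coe_le_norm x).trans (by linarith)⟩

theorem tendsto_kanP_sq_mul_abs_observable_sub {ε : ℝ} (h0 : 0 < ε) (h1 : ε < 1) (k : ℕ)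
    (χ : C(Cylinder, ℝ)) {z w : Cylinder} (hzw : z.1 = w.1) (hz : (z.2 : ℝ) ∈ Ioo (0 : ℝ) 1)
    (hw : (w.2 : ℝ) ∈ Ioo (0 : ℝ) 1) :
    Tendsto (fun n : ℕ => kanP ε ((cylinderMap k (kanFiber ε))^[n] z).1 ^ 2 *
      |χ ((cylinderMap k (kanFiber ε))^[n + 1] z) - χ ((cylinderMap k (kanFiber ε))^[n + 1] w)|)
      atTop (𝓝 0) := by
  have ht := tendsto_kanP_sq_mul_abs_sub h0 h1 k hzw hz hw
  have hfst := cylinderMap_iterate_fst_eq k (kanFiber ε) hzw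
  set F := cylinderMap k (kanFiber ε) with hF
  obtain ⟨C, hC0, hC⟩ := χ.exists_abs_le
  have hu := CompactSpace.uniformContinuous_of_continuous χ.continuous
  rw [Metric.tendsto_atTop']
  intro e he
  obtain ⟨δ, hδ, hχ⟩ := Metric.uniformContinuous_iff.mp hu e he
  -- A gap below `δ` is handled by uniform continuity; for a larger one, the variation `2 * C` of
  -- `χ` is at most `2 * C / δ` times the gap.
  have ht' := ht.const_mul (2 * C / δ)
  rw [mul_zero] at ht'
  obtain ⟨N, hN⟩ := eventually_atTop.mp (ht'.eventually_lt_const he)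
  refine ⟨N, fun n hn => ?_⟩
  have hp := kanP_sq_le_one h0 h1 (F^[n] z).1
  have hp0 := sq_nonneg (kanP ε (F^[n] z).1)
  rw [Real.dist_eq, sub_zero, abs_of_nonneg (by positivity)]
  have hdist : dist (F^[n + 1] z) (F^[n + 1] w) =
      |((F^[n + 1] z).2 : ℝ) - (F^[n + 1] w).2| := by
    rw [Prod.dist_eq, hfst (n + 1), dist_self, max_eq_right dist_nonneg]
    rfl
  by_cases hd : |((F^[n + 1] z).2 : ℝ) - (F^[n + 1] w).2| < δ
  · have := hχ (hdist ▸ hd)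
    rw [Real.dist_eq] at this
    exact (mul_le_of_le_one_left (abs_nonneg _) hp).trans_lt this
  · push Not at hd
    refine lt_of_le_of_lt ?_ (hN n hn.le)
    have hb : |χ (F^[n + 1] z) - χ (F^[n + 1] w)| ≤ 2 * C := by
      refine (abs_sub _ _).trans ?_
      linarith [hC (F^[n + 1] z), hC (F^[n + 1] w)]
    rw [mul_left_comm]
    gcongr
    refine hb.trans ?_
    rw [div_mul_eq_mul_div, le_div_iff₀ hδ]
    gcongr

end Contraction

/-! ### Hopf argument, ergodicity and uniform distribution -/

section Ergodicity

instance isProbabilityMeasure_volume_unitAddCircle :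
    IsProbabilityMeasure (volume : Measure UnitAddCircle) :=
  ⟨UnitAddCircle.measure_univ⟩

instance isProbabilityMeasure_volume_cylinder :
    IsProbabilityMeasure (volume : Measure Cylinder) :=
  inferInstanceAs (IsProbabilityMeasure (Measure.prod volume volume))

theorem MeasureTheory.MeasurePreserving.integral_comp_of_aestronglyMeasurable {α β : Type*}
    [MeasurableSpace α] [MeasurableSpace β] {μ : Measure α} {ν : Measure β} {T : α → β}
    (hT : MeasurePreserving T μ ν) {g : β → ℝ} (hg : AEStronglyMeasurable g ν) :
    ∫ x, g (T x) ∂μ = ∫ y, g y ∂ν := by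
  rw [← hT.map_eq] at hg ⊢
  exact (integral_map hT.aemeasurable hg).symm

/-- Pairs of points of the cylinder in a common fibre. -/
abbrev FibrePair : Type := UnitAddCircle × (unitInterval × unitInterval)

instance isProbabilityMeasure_volume_fibrePair :
    IsProbabilityMeasure (volume : Measure FibrePair) :=
  inferInstanceAs (IsProbabilityMeasure (Measure.prod volume (Measure.prod volume volume)))

/-- The first point of a pair. -/
def FibrePair.left (t : FibrePair) : Cylinder := (t.1, t.2.1)

/-- The second point of a pair. -/
def FibrePair.right (t : FibrePair) : Cylinder := (t.1, t.2.2)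

theorem FibrePair.continuous_left : Continuous FibrePair.left :=
  continuous_fst.prodMk (continuous_fst.comp continuous_snd)

theorem FibrePair.continuous_right : Continuous FibrePair.right :=
  continuous_fst.prodMk (continuous_snd.comp continuous_snd)

theorem FibrePair.measurePreserving_left : MeasurePreserving FibrePair.left volume volume :=
  (MeasurePreserving.id (volume : Measure UnitAddCircle)).prod
    (measurePreserving_fst (μ := (volume : Measure unitInterval))
      (ν := (volume : Measure unitInterval)))

theorem FibrePair.measurePreserving_right : MeasurePreserving FibrePair.right volume volume :=
  (MeasurePreserving.id (volume : Measure UnitAddCircle)).prod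
    (measurePreserving_snd (μ := (volume : Measure unitInterval))
      (ν := (volume : Measure unitInterval)))

theorem ae_snd_mem_Ioo : ∀ᵐ z : Cylinder, (z.2 : ℝ) ∈ Ioo (0 : ℝ) 1 := by
  have h : ∀ᵐ y : unitInterval, (y : ℝ) ∈ Ioo (0 : ℝ) 1 := by
    have hne : ∀ c : unitInterval, ∀ᵐ y : unitInterval, y ≠ c := fun c => by
      rw [ae_iff]
      simp
    filter_upwards [hne 0, hne 1] with y hy0 hy1
    exact ⟨unitInterval.pos_iff_ne_zero.mpr hy0, unitInterval.lt_one_iff_ne_one.mpr hy1⟩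
  exact (measurePreserving_snd (μ := (volume : Measure UnitAddCircle))
      (ν := (volume : Measure unitInterval))).quasiMeasurePreserving.ae h

theorem integrable_of_continuous_compactSpace {X : Type*} [TopologicalSpace X] [CompactSpace X]
    [MeasurableSpace X] [OpensMeasurableSpace X] {μ : Measure X} [IsFiniteMeasure μ]
    {g : X → ℝ} (hg : Continuous g) : Integrable g μ :=
  hg.integrable_of_hasCompactSupport (.of_compactSpace _)

/-- The integrand is a cutoff concentrating on the null set `p = 0`. It complements `m p²` to at
least one, which allows the weight `p²` to be removed from the contraction estimate. -/
theorem tendsto_integral_max_one_sub_mul_kanP_sq {ε : ℝ} (h0 : 0 < ε) :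
    Tendsto (fun m : ℕ => ∫ x : UnitAddCircle, max 0 (1 - m * kanP ε x ^ 2)) atTop (𝓝 0) := by
  have hp := continuous_kanP ε
  suffices key : Tendsto (fun m : ℕ => ∫ x : UnitAddCircle, max 0 (1 - m * kanP ε x ^ 2)) atTop
      (𝓝 (∫ _ : UnitAddCircle, (0 : ℝ))) by rwa [integral_zero] at key
  refine tendsto_integral_of_dominated_convergence (fun _ => 1) (fun m => ?_)
    (integrable_const 1) (fun m => .of_forall fun x => ?_) ?_
  · exact Continuous.aestronglyMeasurable (by fun_prop)
  · have : 0 ≤ (m : ℝ) * kanP ε x ^ 2 := by positivity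
    rw [Real.norm_of_nonneg (le_max_left _ _)]
    exact max_le zero_le_one (by linarith)
  · filter_upwards [ae_kanP_ne_zero h0.ne'] with x hx
    have hx2 : 0 < kanP ε x ^ 2 := by positivity
    refine tendsto_const_nhds.congr' ?_
    filter_upwards [(tendsto_natCast_atTop_atTop (R := ℝ)).eventually_ge_atTop
      (1 / kanP ε x ^ 2)] with m hm
    rw [div_le_iff₀ hx2] at hm
    rw [max_eq_left (by linarith)]

/-- Two typical points of a fibre have asymptotic orbits, in the mean. -/
theorem tendsto_integral_abs_observable_sub {k : ℕ} (hk : 2 ≤ k) {ε : ℝ} (h0 : 0 < ε)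
    (h1 : ε < 1) (χ : C(Cylinder, ℝ)) :
    Tendsto (fun n : ℕ => ∫ t : FibrePair,
      |χ ((cylinderMap k (kanFiber ε))^[n + 1] t.left) -
        χ ((cylinderMap k (kanFiber ε))^[n + 1] t.right)|) atTop (𝓝 0) := by
  have hFc := continuous_cylinderMap_kanFiber h0 h1 k
  have hFm := measurePreserving_cylinderMap_kanFiber hk h0 h1
  have hlim := fun (t : FibrePair) => tendsto_kanP_sq_mul_abs_observable_sub h0 h1 k χ
    (z := t.left) (w := t.right) rfl
  set F := cylinderMap k (kanFiber ε) with hF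
  have hp := continuous_kanP ε
  obtain ⟨C, hC0, hC⟩ := χ.exists_abs_le
  have hL : ∀ n, Continuous fun t : FibrePair => F^[n] t.left :=
    fun n => (hFc.iterate n).comp FibrePair.continuous_left
  have hR : ∀ n, Continuous fun t : FibrePair => F^[n] t.right :=
    fun n => (hFc.iterate n).comp FibrePair.continuous_right
  have hX : ∀ n, Continuous fun t : FibrePair => (F^[n] t.left).1 :=
    fun n => continuous_fst.comp (hL n)
  have hD : ∀ n, Continuous fun t : FibrePair => |χ (F^[n] t.left) - χ (F^[n] t.right)| :=
    fun n => ((χ.continuous.comp (hL n)).sub (χ.continuous.comp (hR n))).abs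
  have hDb : ∀ n (t : FibrePair), |χ (F^[n] t.left) - χ (F^[n] t.right)| ≤ 2 * C := fun n t => by
    refine (abs_sub _ _).trans ?_
    linarith [hC (F^[n] t.left), hC (F^[n] t.right)]
  have hPD : ∀ n, Continuous fun t : FibrePair => kanP ε (F^[n] t.left).1 ^ 2 *
      |χ (F^[n + 1] t.left) - χ (F^[n + 1] t.right)| :=
    fun n => ((hp.comp (hX n)).pow 2).mul (hD (n + 1))
  have hI : Tendsto (fun n => ∫ t : FibrePair, kanP ε (F^[n] t.left).1 ^ 2 *
      |χ (F^[n + 1] t.left) - χ (F^[n + 1] t.right)|) atTop (𝓝 0) := by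
    rw [← integral_zero FibrePair ℝ (μ := volume)]
    refine tendsto_integral_of_dominated_convergence (fun _ => 2 * C)
      (fun n => (hPD n).aestronglyMeasurable) (integrable_const _)
      (fun n => .of_forall fun t => ?_) ?_
    · rw [Real.norm_of_nonneg (by positivity)]
      exact (mul_le_of_le_one_left (abs_nonneg _) (kanP_sq_le_one h0 h1 _)).trans (hDb _ t)
    · filter_upwards [FibrePair.measurePreserving_left.quasiMeasurePreserving.ae ae_snd_mem_Ioo,
        FibrePair.measurePreserving_right.quasiMeasurePreserving.ae ae_snd_mem_Ioo] with t hl hr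
      exact hlim t hl hr
  -- By invariance the base point at time `n` is Lebesgue distributed, so the cutoff bound is
  -- uniform in `n`. This permits fixing `m` before letting `n` grow.
  have hweight : ∀ m n : ℕ, ∫ t : FibrePair, max 0 (1 - m * kanP ε (F^[n] t.left).1 ^ 2) =
      ∫ x : UnitAddCircle, max 0 (1 - m * kanP ε x ^ 2) := by
    intro m n
    have hmp : MeasurePreserving (fun t : FibrePair => (F^[n] t.left).1) volume volume :=
      (measurePreserving_fst (μ := (volume : Measure UnitAddCircle))
        (ν := (volume : Measure unitInterval))).comp
        ((hFm.iterate n).comp FibrePair.measurePreserving_left)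
    exact hmp.integral_comp_of_aestronglyMeasurable
      (g := fun x => max 0 (1 - m * kanP ε x ^ 2))
      (Continuous.aestronglyMeasurable (by fun_prop))
  have hbound : ∀ m n : ℕ, ∫ t : FibrePair, |χ (F^[n + 1] t.left) - χ (F^[n + 1] t.right)| ≤
      2 * C * (∫ x : UnitAddCircle, max 0 (1 - m * kanP ε x ^ 2)) +
        m * ∫ t : FibrePair, kanP ε (F^[n] t.left).1 ^ 2 *
          |χ (F^[n + 1] t.left) - χ (F^[n + 1] t.right)| := by
    intro m n
    have hWc : Continuous fun t : FibrePair =>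
        2 * C * max 0 (1 - m * kanP ε (F^[n] t.left).1 ^ 2) :=
      continuous_const.mul (continuous_const.max
        (continuous_const.sub (continuous_const.mul ((hp.comp (hX n)).pow 2))))
    have hPc : Continuous fun t : FibrePair => (m : ℝ) * (kanP ε (F^[n] t.left).1 ^ 2 *
        |χ (F^[n + 1] t.left) - χ (F^[n + 1] t.right)|) := continuous_const.mul (hPD n)
    rw [← hweight m n, ← integral_const_mul, ← integral_const_mul,
      ← integral_add (integrable_of_continuous_compactSpace hWc)
        (integrable_of_continuous_compactSpace hPc)]
    refine integral_mono (integrable_of_continuous_compactSpace (hD _))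
      (integrable_of_continuous_compactSpace (hWc.add hPc)) fun t => ?_
    have hd := hDb (n + 1) t
    have hd0 := abs_nonneg (χ (F^[n + 1] t.left) - χ (F^[n + 1] t.right))
    have hw0 := le_max_left 0 (1 - m * kanP ε (F^[n] t.left).1 ^ 2)
    have hw1 := le_max_right 0 (1 - m * kanP ε (F^[n] t.left).1 ^ 2)
    have h2 := mul_le_mul_of_nonneg_right hd hw0
    have h3 := mul_le_mul_of_nonneg_right hw1 hd0
    simp only
    linarith
  rw [Metric.tendsto_atTop]
  intro e he
  have hw := (tendsto_integral_max_one_sub_mul_kanP_sq h0).const_mul (2 * C)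
  rw [mul_zero] at hw
  obtain ⟨m, hm⟩ := (hw.eventually_lt_const (half_pos he)).exists
  have hI' := hI.const_mul (m : ℝ)
  rw [mul_zero] at hI'
  obtain ⟨N, hN⟩ := eventually_atTop.mp (hI'.eventually_lt_const (half_pos he))
  refine ⟨N, fun n hn => ?_⟩
  rw [Real.dist_eq, sub_zero, abs_of_nonneg (integral_nonneg fun t => abs_nonneg _)]
  linarith [hbound m n, hN n hn]

/-- An invariant function is almost everywhere constant on the fibres. -/
theorem ae_eq_of_comp_eq {k : ℕ} (hk : 2 ≤ k) {ε : ℝ} (h0 : 0 < ε) (h1 : ε < 1)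
    {g : Cylinder → ℝ} (hg : Integrable g)
    (hinv : ∀ z, g (cylinderMap k (kanFiber ε) z) = g z) :
    ∀ᵐ t : FibrePair, g t.left = g t.right := by
  have hFm := measurePreserving_cylinderMap_kanFiber hk h0 h1
  have hlim := tendsto_integral_abs_observable_sub hk h0 h1
  set F := cylinderMap k (kanFiber ε) with hF
  have hiter : ∀ (n : ℕ) z, g (F^[n] z) = g z := by
    intro n
    induction n with
    | zero => exact fun z => rfl
    | succ n ih => exact fun z => by rw [Function.iterate_succ_apply', hinv, ih]
  have hL := fun n : ℕ => (hFm.iterate n).comp FibrePair.measurePreserving_left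
  have hR := fun n : ℕ => (hFm.iterate n).comp FibrePair.measurePreserving_right
  have hi : Integrable fun t : FibrePair => |g t.left - g t.right| :=
    (((hL 0).integrable_comp_of_integrable hg).sub
      ((hR 0).integrable_comp_of_integrable hg)).abs
  -- Replace `g` by `g ∘ F^[n + 1]` and then by a continuous `χ` that is `η`-close in `L¹`. Both
  -- points of a pair are Lebesgue distributed at every time, so the total error is `2 * η` for each
  -- `n`, while the `χ` term tends to zero.
  have hle : ∀ η : ℝ, 0 < η → ∫ t : FibrePair, |g t.left - g t.right| ≤ 2 * η := by
    intro η hη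
    obtain ⟨χ', -, hχ, hc, hχi⟩ := hg.exists_hasCompactSupport_integral_sub_le hη
    let χ : C(Cylinder, ℝ) := ⟨χ', hc⟩
    have hsub : Integrable fun z => |g z - χ z| := (hg.sub hχi).abs
    have hχ2 : ∫ z, |g z - χ z| ≤ η := hχ
    have hb : ∀ n : ℕ, ∫ t : FibrePair, |g t.left - g t.right| ≤
        2 * η + ∫ t : FibrePair, |χ (F^[n + 1] t.left) - χ (F^[n + 1] t.right)| := by
      intro n
      have i1 : Integrable fun t : FibrePair => |g (F^[n + 1] t.left) - χ (F^[n + 1] t.left)| :=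
        (hL (n + 1)).integrable_comp_of_integrable hsub
      have i2 : Integrable fun t : FibrePair =>
          |g (F^[n + 1] t.right) - χ (F^[n + 1] t.right)| :=
        (hR (n + 1)).integrable_comp_of_integrable hsub
      have i3 : Integrable fun t : FibrePair =>
          |χ (F^[n + 1] t.left) - χ (F^[n + 1] t.right)| :=
        (((hL (n + 1)).integrable_comp_of_integrable hχi).sub
          ((hR (n + 1)).integrable_comp_of_integrable hχi)).abs
      have i12 : Integrable fun t : FibrePair => |g (F^[n + 1] t.left) - χ (F^[n + 1] t.left)| +
          |g (F^[n + 1] t.right) - χ (F^[n + 1] t.right)| := i1.add i2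
      have e1 : ∫ t : FibrePair, |g (F^[n + 1] t.left) - χ (F^[n + 1] t.left)| =
          ∫ z, |g z - χ z| :=
        (hL (n + 1)).integral_comp_of_aestronglyMeasurable hsub.aestronglyMeasurable
      have e2 : ∫ t : FibrePair, |g (F^[n + 1] t.right) - χ (F^[n + 1] t.right)| =
          ∫ z, |g z - χ z| :=
        (hR (n + 1)).integral_comp_of_aestronglyMeasurable hsub.aestronglyMeasurable
      have h3 : ∫ t : FibrePair, |g t.left - g t.right| ≤
          ∫ t : FibrePair, ((|g (F^[n + 1] t.left) - χ (F^[n + 1] t.left)| +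
            |g (F^[n + 1] t.right) - χ (F^[n + 1] t.right)|) +
            |χ (F^[n + 1] t.left) - χ (F^[n + 1] t.right)|) := by
        refine integral_mono hi (i12.add i3) fun t => ?_
        simp only [hiter]
        have t1 := abs_sub_le (g t.left) (χ (F^[n + 1] t.left)) (g t.right)
        have t2 := abs_sub_le (χ (F^[n + 1] t.left)) (χ (F^[n + 1] t.right)) (g t.right)
        rw [abs_sub_comm (χ (F^[n + 1] t.right))] at t2
        linarith
      rw [integral_add i12 i3, integral_add i1 i2, e1, e2] at h3
      linarith
    have := ge_of_tendsto' ((hlim χ).const_add (2 * η)) hb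
    simpa using this
  have hzero : ∫ t : FibrePair, |g t.left - g t.right| = 0 := by
    refine le_antisymm (le_of_forall_pos_le_add fun η hη => ?_)
      (integral_nonneg fun t => abs_nonneg _)
    linarith [hle (η / 2) (half_pos hη)]
  rw [integral_eq_zero_iff_of_nonneg (fun t => abs_nonneg _) hi] at hzero
  filter_upwards [hzero] with t ht
  exact sub_eq_zero.mp (abs_eq_zero.mp ht)

/-- The cylinder map is ergodic with respect to Lebesgue measure. -/
theorem ergodic_cylinderMap_kanFiber {k : ℕ} (hk : 2 ≤ k) {ε : ℝ} (h0 : 0 < ε) (h1 : ε < 1) :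
    Ergodic (cylinderMap k (kanFiber ε)) (volume : Measure Cylinder) := by
  have hFm := measurePreserving_cylinderMap_kanFiber hk h0 h1
  refine ⟨hFm, ⟨fun A hA hAinv => ?_⟩⟩
  set g : Cylinder → ℝ := A.indicator 1 with hg
  have hgm : Measurable g := measurable_const.indicator hA
  have hgi : Integrable g := (integrable_const (1 : ℝ)).indicator hA
  have hginv : ∀ z, g (cylinderMap k (kanFiber ε) z) = g z := by
    intro z
    have : cylinderMap k (kanFiber ε) z ∈ A ↔ z ∈ A := by
      conv_rhs => rw [← hAinv]
      rfl
    by_cases hz : z ∈ A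
    · rw [hg, indicator_of_mem hz, indicator_of_mem (this.mpr hz)]
      rfl
    · rw [hg, indicator_of_notMem hz, indicator_of_notMem (this.not.mpr hz)]
  have hpair := ae_eq_of_comp_eq hk h0 h1 hgi hginv
  -- The fibre average of the indicator. Constancy on almost every fibre makes `g z = G z.1` almost
  -- everywhere, so `G` is invariant under `x ↦ k • x`.
  set G : UnitAddCircle → ℝ := fun x => ∫ y : unitInterval, g (x, y) with hG
  have hGm : StronglyMeasurable G := hgm.stronglyMeasurable.integral_prod_right'
  have hgG : ∀ᵐ z : Cylinder, g z = G z.1 := by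
    have hm : MeasurableSet {z : Cylinder | g z = G z.1} :=
      measurableSet_eq_fun hgm (hGm.measurable.comp measurable_fst)
    refine (Measure.ae_prod_iff_ae_ae hm).mpr ?_
    filter_upwards [Measure.ae_ae_of_ae_prod hpair] with x hx
    filter_upwards [Measure.ae_ae_of_ae_prod hx] with y hy
    have : ∫ y' : unitInterval, g (x, y') = ∫ _ : unitInterval, g (x, y) :=
      integral_congr_ae (hy.mono fun y' h => h.symm)
    simp only [hG, this]
    simp
  have hGinv : (G ∘ fun x => k • x) =ᵐ[volume] G := by
    have h2 : ∀ᵐ z : Cylinder, G (k • z.1) = G z.1 := by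
      filter_upwards [hgG, hFm.quasiMeasurePreserving.ae hgG] with z hz hFz
      rw [← hz, ← hginv z, hFz]
      rfl
    filter_upwards [Measure.ae_ae_of_ae_prod h2] with x hx
    -- The statement does not involve the height, so one point of the fibre suffices.
    exact hx.exists.choose_spec
  obtain ⟨c, hc⟩ := (AddCircle.ergodic_nsmul hk).ae_eq_const_of_ae_eq_comp_ae
    hGm.aestronglyMeasurable hGinv
  have hgc : ∀ᵐ z : Cylinder, g z = c := by
    filter_upwards [hgG, (measurePreserving_fst (μ := (volume : Measure UnitAddCircle))
      (ν := (volume : Measure unitInterval))).quasiMeasurePreserving.ae hc] with z hz hz1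
    exact hz.trans hz1
  rw [eventuallyConst_set]
  by_cases h : c = 1
  · left
    filter_upwards [hgc] with z hz
    by_contra hzA
    rw [hg, indicator_of_notMem hzA, h] at hz
    exact zero_ne_one hz
  · right
    filter_upwards [hgc] with z hz hzA
    rw [hg, indicator_of_mem hzA] at hz
    exact h hz.symm

/-- Almost every orbit of an ergodic transformation of a compact space is uniformly distributed. -/
theorem Ergodic.ae_forall_continuousMap_tendsto {X : Type*} [TopologicalSpace X] [CompactSpace X]
    [MeasurableSpace X] [OpensMeasurableSpace X] [TopologicalSpace.SeparableSpace C(X, ℝ)]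
    {μ : Measure X} [IsProbabilityMeasure μ] {T : X → X} (hT : Ergodic T μ) :
    ∀ᵐ z ∂μ, ∀ χ : C(X, ℝ),
      Tendsto (fun n : ℕ => (∑ i ∈ Finset.range n, χ (T^[i] z)) / (n : ℝ)) atTop
        (𝓝 (∫ w, χ w ∂μ)) := by
  have hi : ∀ χ : C(X, ℝ), Integrable χ μ := fun χ =>
    integrable_of_continuous_compactSpace χ.continuous
  -- A countable dense family of observables leaves a single exceptional null set; other observables
  -- follow by uniform approximation.
  have hdense : ∀ᵐ z ∂μ, ∀ m : ℕ, Tendsto (fun n : ℕ =>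
      birkhoffSum T (TopologicalSpace.denseSeq C(X, ℝ) m) n z / n) atTop
        (𝓝 (∫ w, TopologicalSpace.denseSeq C(X, ℝ) m w ∂μ)) := by
    rw [ae_all_iff]
    exact fun m => hT.ae_tendsto_birkhoffSum_div (ContinuousMap.continuous _).measurable (hi _)
  filter_upwards [hdense] with z hz χ
  rw [Metric.tendsto_atTop]
  intro e he
  obtain ⟨m, hm⟩ := (TopologicalSpace.denseRange_denseSeq C(X, ℝ)).exists_dist_lt χ
    (by positivity : 0 < e / 3)
  set ψ := TopologicalSpace.denseSeq C(X, ℝ) m with hψ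
  have hclose : ∀ w, |χ w - ψ w| ≤ e / 3 := fun w =>
    (ContinuousMap.dist_apply_le_dist w).trans hm.le
  obtain ⟨N, hN⟩ := Metric.tendsto_atTop.mp (hz m) (e / 3) (by positivity)
  refine ⟨N, fun n hn => ?_⟩
  have h1 := hN n hn
  have h2 : |(∑ i ∈ Finset.range n, χ (T^[i] z)) / (n : ℝ) - birkhoffSum T ψ n z / n| ≤
      e / 3 := by
    rw [birkhoffSum, ← sub_div, ← Finset.sum_sub_distrib, abs_div, Nat.abs_cast]
    refine div_le_of_le_mul₀ (by positivity) (by positivity) ?_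
    refine (Finset.abs_sum_le_sum_abs _ _).trans ?_
    refine (Finset.sum_le_card_nsmul _ _ (e / 3) fun i _ => hclose _).trans_eq ?_
    rw [Finset.card_range, nsmul_eq_mul, mul_comm]
  have h3 : |(∫ w, ψ w ∂μ) - ∫ w, χ w ∂μ| ≤ e / 3 := by
    rw [← integral_sub (hi _) (hi _)]
    have h := norm_integral_le_of_norm_le_const (μ := μ) (f := fun w => ψ w - χ w) (C := e / 3)
      (.of_forall fun w => by rw [Real.norm_eq_abs, abs_sub_comm]; exact hclose w)
    simpa using h
  rw [Real.dist_eq] at h1 ⊢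
  rw [abs_lt] at h1 ⊢
  rw [abs_le] at h2 h3
  constructor <;> linarith [h1.1, h1.2, h2.1, h2.2, h3.1, h3.2]

/-- Two sets of full Lebesgue measure meet, and along a common orbit the limits determine the
integrals of all continuous functions. -/
theorem IsAsymptoticMeasure.unique {F : Cylinder → Cylinder} {μ ν : Measure Cylinder}
    (hμ : IsAsymptoticMeasure F μ) (hν : IsAsymptoticMeasure F ν) : μ = ν := by
  have := hμ.1
  have := hν.1
  obtain ⟨z, hz1, hz2⟩ := (hμ.2.and hν.2).exists
  exact ext_of_forall_integral_eq_of_IsFiniteMeasure fun f =>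
    tendsto_nhds_unique (hz1 f.toContinuousMap) (hz2 f.toContinuousMap)

end Ergodicity

end

/-! ### Assembly of the main theorem -/

theorem mainTheorem4 (k : ℕ) (hk : 2 ≤ k) (ε : ℝ) (hε0 : 0 < ε) (hε1 : ε < 1) :
    -- the maps `f_x` are orientation preserving diffeomorphisms of `[0,1]`
    (∀ x : UnitAddCircle,
      BijOn (kanFiber ε x) (Icc 0 1) (Icc 0 1) ∧
      ContDiffOn ℝ ∞ (kanFiber ε x) (Icc 0 1) ∧
      ∀ y ∈ Icc (0 : ℝ) 1, 0 < derivWithin (kanFiber ε x) (Icc 0 1) y) ∧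
    -- positive Schwarzian whenever `p(x) ≠ 0`, hence almost everywhere
    (∀ x : UnitAddCircle, kanP ε x ≠ 0 →
      ∀ y ∈ Icc (0 : ℝ) 1, 0 < schwarzian (kanFiber ε x) y) ∧
    (∀ᵐ z ∂(volume : Measure Cylinder), 0 < schwarzian (kanFiber ε z.1) z.2) ∧
    -- both transverse Lyapunov exponents are strictly positive
    0 < transverseLyap (kanFiber ε) 0 ∧
    0 < transverseLyap (kanFiber ε) 1 ∧
    -- the `k` branches of the inverse of `F`, and their Jacobians
    (∀ x : ℝ, ∀ y ∈ Icc (0 : ℝ) 1,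
      BijOn (fun j : ℕ => toCylinder (inverseBranch k ε j (x, y))) (Iio k)
        (cylinderMap k (kanFiber ε) ⁻¹' {toCylinder (x, y)}) ∧
      (∀ j < k,
        DifferentiableAt ℝ (inverseBranch k ε j) (x, y) ∧
        (fderiv ℝ (inverseBranch k ε j) (x, y)).det =
          (1 + ε * Real.cos (2 * Real.pi * ((x + j) / k)) * (1 - 2 * y)) / k ∧
        0 < (fderiv ℝ (inverseBranch k ε j) (x, y)).det) ∧
      ∑ j ∈ Finset.range k, (fderiv ℝ (inverseBranch k ε j) (x, y)).det = 1) ∧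
    -- Lebesgue measure is `F`-invariant
    MeasurePreserving (cylinderMap k (kanFiber ε)) (volume : Measure Cylinder) volume ∧
    -- Lebesgue measure is the one and only asymptotic measure of `F`
    IsAsymptoticMeasure (cylinderMap k (kanFiber ε)) (volume : Measure Cylinder) ∧
    (∀ ν : Measure Cylinder,
      IsAsymptoticMeasure (cylinderMap k (kanFiber ε)) ν → ν = volume) := by
  have ha := abs_kanP_lt_one hε0 hε1
  have hF := ergodic_cylinderMap_kanFiber hk hε0 hε1
  have hA : IsAsymptoticMeasure (cylinderMap k (kanFiber ε)) (volume : Measure Cylinder) :=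
    ⟨inferInstance, hF.ae_forall_continuousMap_tendsto⟩
  refine ⟨fun x => ⟨bijOn_kanQInv (ha x), contDiffOn_kanQInv (ha x), fun y hy => ?_⟩,
    fun x hx y hy => schwarzian_kanQInv_pos (ha x) hx hy, ?_,
    transverseLyap_kanFiber_zero_pos hε0 hε1, transverseLyap_kanFiber_one_pos hε0 hε1,
    fun x y hy => ⟨bijOn_inverseBranch (by omega) hε0 hε1 x hy, fun j hj => ?_, ?_⟩,
    hF.toMeasurePreserving, hA, fun ν hν => hν.unique hA⟩
  · rw [kanFiber, derivWithin_kanQInv (ha x) hy]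
    exact inv_pos.mpr (Real.sqrt_pos.mpr (kanDisc_pos (ha x) hy))
  · filter_upwards [(measurePreserving_fst (μ := (volume : Measure UnitAddCircle))
      (ν := (volume : Measure unitInterval))).quasiMeasurePreserving.ae
      (ae_kanP_ne_zero hε0.ne')] with z hz
    exact schwarzian_kanQInv_pos (ha z.1) hz z.2.2
  · obtain ⟨A, hA, hdet⟩ := hasFDerivAt_inverseBranch k ε j x y
    have hpos := kanQ_deriv_pos (ha (((x + j) / k : ℝ) : UnitAddCircle)) hy
    rw [kanP_coe] at hpos
    rw [hA.fderiv, hdet]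
    exact ⟨hA.differentiableAt, rfl, div_pos hpos (by exact_mod_cast (by omega : 0 < k))⟩
  -- Each Jacobian splits into `1/k` and a multiple, independent of `j`, of a cosine; the cosines
  -- sum to zero.
  · have h : ∀ j ∈ Finset.range k, (fderiv ℝ (inverseBranch k ε j) (x, y)).det =
        1 / k + Real.cos (2 * Real.pi * ((x + j) / k)) * (ε * (1 - 2 * y) / k) := by
      intro j _
      obtain ⟨A, hA, hdet⟩ := hasFDerivAt_inverseBranch k ε j x y
      rw [hA.fderiv, hdet]
      ring
    have hk0 : (k : ℝ) ≠ 0 := by exact_mod_cast (by omega : k ≠ 0)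
    rw [Finset.sum_congr rfl h, Finset.sum_add_distrib, ← Finset.sum_mul,
      sum_cos_two_pi_mul_add_div hk]
    simp [hk0]
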